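/- Fix a Schwartz function $\phi\in\mathcal S(\mathbb R)$ with $\operatorname{supp}\hat\phi\subset[-1/2,1/2]$, and put $\phi_t(x)=\frac1t\phi(x/t)$ for $t>0$. Then there is a constant $C=C_\phi<\infty$, depending only on $\phi$, such that the following holds for every integer $N\ge 2$, every real $q>2$ and all $f_1,\dots,f_N\in L^2(\mathbb R)$ (complex valued). For $x\in\mathbb R$ and $\lambda>0$ let $M_\lambda(x)$ be the $\ell^2([N])$-$\lambda$-entropy of the trajectory $A(x)=\{(f_1*\phi_t(x),\dots,f_N*\phi_t(x)):t>0\}\subset\mathbb C^N$, that is, the smallest number of closed $\ell^2$-balls of radius $\lambda$, with arbitrary centres in $\mathbb C^N$, needed to cover $A(x)$, with the convention that $M_\lambda(x)=0$ if $A(x)$ is contained in the ball of radius $\lambda$ about the origin (equivalently, up to one value of $\lambda$, the integral below is taken only over $0<\lambda<\sup_{t>0}\|(f_j*\phi_t(x))_j\|_{\ell^2}$). Then $$\left\|\int_0^\infty\min\left\{M_\lambda(x)^{1/2},\,N^{1/2}M_\lambda(x)^{1/q}\right\}d\lambda\right\|_{L^2_x(\mathbb R)}\le C\left(\log N\cdot\frac{q}{q-2}\right)^2\left\|\Big(\sum_{j=1}^N|f_j|^2\Big)^{1/2}\right\|_{L^2(\mathbb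 R)}.$$ -/

import Mathlib

open MeasureTheory Set
open scoped NNReal ENNReal SchwartzMap FourierTransform Convolution

noncomputable section

/-- The `L¹`-normalized dilation `φ_t(x) = t⁻¹ φ(x / t)`, used for `t > 0`. -/
def dilate (φ : 𝓢(ℝ, ℂ)) (t : ℝ) (x : ℝ) : ℂ := (t : ℂ)⁻¹ * φ (x / t)

/-- The trajectory `{ (f₁ * φ_t (x), …, f_N * φ_t (x)) : t > 0 }` in the Hilbert space `ℓ²([N])`. -/
def trajectory (φ : 𝓢(ℝ, ℂ)) {N : ℕ} (f : Fin N → ℝ → ℂ) (x : ℝ) :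
    Set (EuclideanSpace ℂ (Fin N)) :=
  {v | ∃ t : ℝ, 0 < t ∧
    ∀ j, v j = (f j ⋆[ContinuousLinearMap.mul ℂ ℂ, volume] dilate φ t) x}

open Classical in
/-- The `H`-`l`-entropy `M_l(A)`: the fewest number of `l`-balls (with arbitrary centres in `H`)
needed to cover `A`, read as `0` as soon as `A` lies in the `l`-ball about the origin.  (The bare
covering number of a non-empty set is at least `1` for all `l`, and is not integrable over
`0 < l < ∞`.) -/
def entropy {H : Type*} [NormedAddCommGroup H] (l : ℝ≥0) (A : Set H) : ℕ∞ :=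
  if A ⊆ Metric.closedBall 0 (l : ℝ) then 0 else Metric.externalCoveringNumber l A

/-- `∫_0^∞ min { M_l(A)^{1/2}, N^{1/2} M_l(A)^{1/q} } dl`, as an element of `[0, ∞]`. -/
def entropyIntegral {H : Type*} [NormedAddCommGroup H] (N : ℕ) (q : ℝ) (A : Set H) : ℝ≥0∞ :=
  ∫⁻ l in Ioi (0 : ℝ),
    min ((entropy l.toNNReal A : ℝ≥0∞) ^ (1 / 2 : ℝ))
      ((N : ℝ≥0∞) ^ (1 / 2 : ℝ) * (entropy l.toNNReal A : ℝ≥0∞) ^ (1 / q))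

end

/-! Write f = (f_1, ..., f_N), let E_k f be the average of f over the dyadic cells of length 2^(-k),
and put c = ∫ φ. The proof compares the trajectory with the dyadic martingale c E_k f, all in a
Hilbert space and with constants that do not see the dimension.

Comparison. For t in [2^(-k), 2^(1-k)] the vector f * φ_t(x) stays within `blockError` e_k(x) of c
E_k f(x). Almost orthogonality of martingale differences
(`KernelBound.tsum_lintegral_discrepancy_le`), applied to φ and to the mean-zero kernel generating
∂_t φ_t, gives ∫ Σ_k e_k² ≲ ‖f‖² (`exists_tsum_lintegral_blockError_sq_le`). Hence the entropy at
height about 2^j is at most the number of 2^j-jumps of the martingale, plus 3, plus 2 · 2^(-2j) Σ_k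
e_k² (`externalCoveringNumber_smearOrbit_le`).

Jumps. At one height, 2^(2j) times the number of jumps is paid for by the martingale's variance, but
all heights at once would use that variance infinitely often. So jumps of size 2^j are counted only
at cells where the running maximum of ‖E_k f‖ lies in (2^j, 2^(j+m)]. A cell then serves at most m
heights, and ∫ Σ_j 2^(2j) #jumps_j ≤ m ‖f‖² (`IsTreeMartingale.lintegral_tsum_jumpCount_le`). At a
point whose full maximum is at most 2^(j+m) nothing is lost: where the gate is closed, the
martingale lies in the 2^j-ball about 0.

Summation over heights. Let F be the martingale maximal function plus (Σ e_k²)^(1/2). The entropy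
vanishes above a multiple of F, and the heights near 2^(-i) F contribute at most w_i D_i^(1/2), up
to a constant, with w_i = min(1, N^(1/2) 2^(-i(1-2/q))) and ∫ D_i ≲ (i+1) ‖f‖²
(`entropyIntegral_le`). Cauchy–Schwarz leaves Σ (i+1) w_i. The weights start to decay after about
log N · q/(q-2) terms, so this sum is of the order of the square of that number
(`tsum_heightWeight_mul_le`). -/

noncomputable section

/-! ### The dyadic cells of the line -/

/-- The index of the dyadic interval of length `2 ^ (-k)` that contains `x`. -/
def cellIndex (k : ℤ) (x : ℝ) : ℤ := ⌊(2 : ℝ) ^ k * x⌋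

/-- The half-open dyadic interval of length `2 ^ (-k)` with index `n`. -/
def cell (k n : ℤ) : Set ℝ := cellIndex k ⁻¹' {n}

theorem measurable_cellIndex (k : ℤ) : Measurable (cellIndex k) :=
  Int.measurable_floor.comp (measurable_const_mul _)

theorem measurableSet_cell (k n : ℤ) : MeasurableSet (cell k n) :=
  measurable_cellIndex k (measurableSet_singleton n)

theorem mem_cell_self (k : ℤ) (x : ℝ) : x ∈ cell k (cellIndex k x) := rfl

theorem iUnion_cell (k : ℤ) : ⋃ n, cell k n = univ :=
  eq_univ_of_forall fun x => mem_iUnion.2 ⟨_, mem_cell_self k x⟩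

theorem pairwise_disjoint_cell (k : ℤ) : Pairwise (Function.onFun Disjoint (cell k)) := by
  intro m n hmn
  rw [Function.onFun, Set.disjoint_left]
  rintro x hx hy
  exact hmn (hx.symm.trans hy)

theorem cell_eq_Ico (k n : ℤ) :
    cell k n = Ico ((n : ℝ) * 2 ^ (-k)) ((n : ℝ) * 2 ^ (-k) + 2 ^ (-k)) := by
  have h2 : (0 : ℝ) < 2 ^ k := by positivity
  ext x
  simp only [cell, mem_preimage, mem_singleton_iff, cellIndex, Int.floor_eq_iff, mem_Ico, zpow_neg,
    ← div_eq_mul_inv, div_le_iff₀ h2]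
  rw [← one_div, ← add_div, lt_div_iff₀ h2, mul_comm]

theorem volume_cell (k n : ℤ) : volume (cell k n) = ENNReal.ofReal (2 ^ (-k)) := by
  rw [cell_eq_Ico, Real.volume_Ico]
  congr 1
  ring

/-- Ancestry in the dyadic tree becomes integer division of indices, so the recursions below can
refer to a parent as `n / 2`. -/
theorem cellIndex_succ_div (k : ℤ) (x : ℝ) : cellIndex (k + 1) x / 2 = cellIndex k x := by
  symm
  rw [cellIndex, Int.floor_eq_iff]
  have h1 : (2 : ℝ) ^ (k + 1) * x = 2 * (2 ^ k * x) := by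
    rw [zpow_add_one₀ (by norm_num)]; ring
  set m := cellIndex (k + 1) x with hm
  have hf : (m : ℝ) ≤ 2 * (2 ^ k * x) ∧ 2 * (2 ^ k * x) < m + 1 := by
    rw [← h1]; exact Int.floor_eq_iff.1 rfl
  have h3 : 2 * (m / 2) ≤ m ∧ m + 1 ≤ 2 * (m / 2) + 2 := by omega
  have h4 : (2 : ℝ) * ((m / 2 : ℤ) : ℝ) ≤ m := by exact_mod_cast h3.1
  have h5 : (m : ℝ) + 1 ≤ 2 * ((m / 2 : ℤ) : ℝ) + 2 := by exact_mod_cast h3.2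
  constructor <;> linarith

theorem cell_eq_union (k n : ℤ) : cell k n = cell (k + 1) (2 * n) ∪ cell (k + 1) (2 * n + 1) := by
  ext x
  simp only [cell, mem_preimage, mem_singleton_iff, mem_union, ← cellIndex_succ_div k x]
  omega

theorem disjoint_children (k n : ℤ) :
    Disjoint (cell (k + 1) (2 * n)) (cell (k + 1) (2 * n + 1)) :=
  pairwise_disjoint_cell (k + 1) (by omega)

theorem lintegral_eq_tsum_cell (k : ℤ) (g : ℝ → ℝ≥0∞) :
    ∫⁻ x, g x = ∑' n, ∫⁻ x in cell k n, g x := by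
  rw [← lintegral_iUnion (measurableSet_cell k) (pairwise_disjoint_cell k), iUnion_cell,
    Measure.restrict_univ]

theorem setLIntegral_cell_cellIndex (k n : ℤ) (G : ℤ → ℝ≥0∞) :
    ∫⁻ x in cell k n, G (cellIndex k x) = G n * ENNReal.ofReal (2 ^ (-k)) := by
  rw [setLIntegral_congr_fun (measurableSet_cell k n) (g := fun _ => G n)
    (fun x hx => congrArg G hx), setLIntegral_const, volume_cell]

theorem lintegral_cellIndex (k : ℤ) (G : ℤ → ℝ≥0∞) :
    ∫⁻ x, G (cellIndex k x) = (∑' n, G n) * ENNReal.ofReal (2 ^ (-k)) := by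
  rw [lintegral_eq_tsum_cell k]
  simp_rw [setLIntegral_cell_cellIndex, ENNReal.tsum_mul_right]

theorem measurable_comp_cellIndex {α : Type*} [MeasurableSpace α] (k : ℤ) (G : ℤ → α) :
    Measurable fun x => G (cellIndex k x) :=
  (measurable_of_countable G).comp (measurable_cellIndex k)

/-- Even and odd indices are the two children of a cell, each of half its length. This is the tower
property behind every one-step estimate on the tree. -/
theorem lintegral_cellIndex_succ (k : ℤ) (G : ℤ → ℝ≥0∞) :
    2 * ∫⁻ x, G (cellIndex (k + 1) x) =
      ∫⁻ x, (G (2 * cellIndex k x) + G (2 * cellIndex k x + 1)) := by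
  have h2 : (2 : ℝ≥0∞) * ENNReal.ofReal (2 ^ (-(k + 1))) = ENNReal.ofReal (2 ^ (-k)) := by
    rw [show (2 : ℝ≥0∞) = ENNReal.ofReal 2 by simp, ← ENNReal.ofReal_mul (by norm_num), neg_add,
      zpow_add₀ (by norm_num)]
    congr 1
    norm_num
    ring
  have h : ∑' n, G n = ∑' n : ℤ, (G (2 * n) + G (2 * n + 1)) := by
    rw [← (Int.divModEquiv 2).symm.tsum_eq, ENNReal.tsum_prod']
    refine tsum_congr fun n => ?_
    rw [tsum_fintype, Fin.sum_univ_two]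
    simp [Int.divModEquiv, mul_comm]
  rw [lintegral_cellIndex, lintegral_cellIndex k (fun n => G (2 * n) + G (2 * n + 1)), ← h, ← h2]
  ring

/-- A nonnegative process on the dyadic tree whose conditional increments are at most `h`. -/
theorem lintegral_process_le (k : ℤ) (G h : ℕ → ℤ → ℝ) (hG : ∀ d n, 0 ≤ G d n)
    (hh : ∀ d n, 0 ≤ h d n)
    (step : ∀ d n, G (d + 1) (2 * n) + G (d + 1) (2 * n + 1) ≤ 2 * G d n + 2 * h d n) (D : ℕ) :
    ∫⁻ x, ENNReal.ofReal (G D (cellIndex (k + D) x)) ≤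
      (∫⁻ x, ENNReal.ofReal (G 0 (cellIndex k x))) +
        ∑ d ∈ Finset.range D, ∫⁻ x, ENNReal.ofReal (h d (cellIndex (k + d) x)) := by
  induction D with
  | zero => simp
  | succ D ih =>
    rw [Finset.sum_range_succ, ← add_assoc]
    refine le_trans ?_ (add_le_add_left ih _)
    have h2 : (2 : ℝ≥0∞) ≠ 0 := by norm_num
    rw [← ENNReal.mul_le_mul_iff_right h2 (by norm_num), Nat.cast_succ, ← add_assoc,
      lintegral_cellIndex_succ (k + D) (fun n => ENNReal.ofReal (G (D + 1) n)), mul_add,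
      ← lintegral_const_mul' _ _ (by norm_num), ← lintegral_const_mul' _ _ (by norm_num),
      ← lintegral_add_left
        (measurable_comp_cellIndex (k + D) fun n => 2 * ENNReal.ofReal (G D n))]
    refine lintegral_mono fun x => ?_
    dsimp only
    rw [← ENNReal.ofReal_add (hG _ _) (hG _ _), show (2 : ℝ≥0∞) = ENNReal.ofReal 2 by simp,
      ← ENNReal.ofReal_mul (by norm_num), ← ENNReal.ofReal_mul (by norm_num),
      ← ENNReal.ofReal_add (by have := hG D (cellIndex (k + D) x); positivity)
        (by have := hh D (cellIndex (k + D) x); positivity)]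
    exact ENNReal.ofReal_le_ofReal (step _ _)

/-- The exact counterpart of `lintegral_process_le`. -/
theorem lintegral_process_eq (k : ℤ) (G h : ℤ → ℤ → ℝ) (hG : ∀ d n, 0 ≤ G d n)
    (hh : ∀ d n, 0 ≤ h d n)
    (step : ∀ d n, G (d + 1) (2 * n) + G (d + 1) (2 * n + 1) = 2 * G d n + 2 * h d n) (D : ℕ) :
    ∫⁻ x, ENNReal.ofReal (G (k + D) (cellIndex (k + D) x)) =
      (∫⁻ x, ENNReal.ofReal (G k (cellIndex k x))) +
        ∑ d ∈ Finset.range D, ∫⁻ x, ENNReal.ofReal (h (k + d) (cellIndex (k + d) x)) := by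
  induction D with
  | zero => simp
  | succ D ih =>
    rw [Finset.sum_range_succ, ← add_assoc, ← ih]
    have h2 : (2 : ℝ≥0∞) ≠ 0 := by norm_num
    rw [← ENNReal.mul_right_inj h2 (by norm_num), Nat.cast_succ, ← add_assoc,
      lintegral_cellIndex_succ (k + D) (fun n => ENNReal.ofReal (G (k + D + 1) n)), mul_add,
      ← lintegral_const_mul' _ _ (by norm_num), ← lintegral_const_mul' _ _ (by norm_num),
      ← lintegral_add_left
        (measurable_comp_cellIndex (k + D) fun n => 2 * ENNReal.ofReal (G (k + D) n))]
    refine lintegral_congr fun x => ?_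
    rw [← ENNReal.ofReal_add (hG _ _) (hG _ _), show (2 : ℝ≥0∞) = ENNReal.ofReal 2 by simp,
      ← ENNReal.ofReal_mul (by norm_num), ← ENNReal.ofReal_mul (by norm_num),
      ← ENNReal.ofReal_add (by have := hG (k + D) (cellIndex (k + D) x); positivity)
        (by have := hh (k + D) (cellIndex (k + D) x); positivity), step]

/-! ### Martingales on the dyadic tree -/

section TreeMartingale

variable {H : Type*} [NormedAddCommGroup H]

/-- The value at a dyadic cell is the mean of the values at its two children. -/
def IsTreeMartingale (U : ℤ → ℤ → H) : Prop :=
  ∀ k n, U (k + 1) (2 * n) + U (k + 1) (2 * n + 1) = U k n + U k n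

/-- The conditional variance of the next increment of a martingale on the dyadic tree. -/
def treeVar (U : ℤ → ℤ → H) (k n : ℤ) : ℝ := ‖U (k + 1) (2 * n) - U k n‖ ^ 2

theorem treeVar_nonneg (U : ℤ → ℤ → H) (k n : ℤ) : 0 ≤ treeVar U k n := by
  unfold treeVar; positivity

variable {U : ℤ → ℤ → H}

theorem IsTreeMartingale.sub_eq (hU : IsTreeMartingale U) (k n : ℤ) :
    U (k + 1) (2 * n + 1) - U k n = -(U (k + 1) (2 * n) - U k n) := by
  have h := hU k n
  rw [← sub_eq_zero] at h ⊢
  rw [← h]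
  abel

theorem IsTreeMartingale.norm_sub_sq (hU : IsTreeMartingale U) (k c : ℤ) :
    ‖U (k + 1) c - U k (c / 2)‖ ^ 2 = treeVar U k (c / 2) := by
  rcases Int.emod_two_eq_zero_or_one c with h | h
  · rw [treeVar, show 2 * (c / 2) = c by omega]
  · rw [treeVar, ← norm_neg (U (k + 1) (2 * (c / 2)) - _), ← hU.sub_eq, show 2 * (c / 2) + 1 = c by omega]

/-- The two children lie symmetrically about the parent value, so this is the parallelogram law. The
freedom in `a` lets squared distances be measured from a frozen anchor. -/
theorem IsTreeMartingale.norm_sq_add [InnerProductSpace ℂ H] (hU : IsTreeMartingale U)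
    (k n : ℤ) (a : H) :
    ‖U (k + 1) (2 * n) - a‖ ^ 2 + ‖U (k + 1) (2 * n + 1) - a‖ ^ 2 =
      2 * ‖U k n - a‖ ^ 2 + 2 * treeVar U k n := by
  have h := parallelogram_law_with_norm ℂ (U k n - a) (U (k + 1) (2 * n) - U k n)
  rw [show U k n - a + (U (k + 1) (2 * n) - U k n) = U (k + 1) (2 * n) - a by abel,
    show U k n - a - (U (k + 1) (2 * n) - U k n) = U (k + 1) (2 * n + 1) - a by
      rw [sub_eq_add_neg (U k n - a), ← hU.sub_eq]; abel] at h
  rw [treeVar]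
  linarith

theorem IsTreeMartingale.lintegral_sq [InnerProductSpace ℂ H] (hU : IsTreeMartingale U)
    (k : ℤ) (D : ℕ) :
    ∫⁻ x, ENNReal.ofReal (‖U (k + D) (cellIndex (k + D) x)‖ ^ 2) =
      (∫⁻ x, ENNReal.ofReal (‖U k (cellIndex k x)‖ ^ 2)) +
        ∑ d ∈ Finset.range D, ∫⁻ x, ENNReal.ofReal (treeVar U (k + d) (cellIndex (k + d) x)) :=
  lintegral_process_eq k (fun k n => ‖U k n‖ ^ 2) (treeVar U) (fun _ _ => by positivity)
    (treeVar_nonneg U) (fun k n => by simpa using hU.norm_sq_add k n 0) D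

/-- The maximum of `‖U‖` over the cells of levels `k, …, k + d` containing a given cell. -/
def runMax (U : ℤ → ℤ → H) (k : ℤ) : ℕ → ℤ → ℝ
  | 0, n => ‖U k n‖
  | d + 1, n => max (runMax U k d (n / 2)) ‖U (k + (d + 1 : ℕ)) n‖

theorem runMax_nonneg (k : ℤ) (d : ℕ) (n : ℤ) : 0 ≤ runMax U k d n := by
  cases d with
  | zero => exact norm_nonneg _
  | succ d => exact le_max_of_le_right (norm_nonneg _)

theorem le_runMax (k : ℤ) {i d : ℕ} (hid : i ≤ d) (x : ℝ) :
    ‖U (k + i) (cellIndex (k + i) x)‖ ≤ runMax U k d (cellIndex (k + d) x) := by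
  induction d, hid using Nat.le_induction with
  | base =>
    cases i with
    | zero => simp [runMax]
    | succ i => exact le_max_right _ _
  | succ d _ ih =>
    refine ih.trans ?_
    rw [runMax, Nat.cast_succ, ← add_assoc, cellIndex_succ_div]
    exact le_max_left _ _

/-- Doob's maximal inequality in `L²`. -/
theorem IsTreeMartingale.lintegral_runMax_sq_le [InnerProductSpace ℂ H] (hU : IsTreeMartingale U)
    {B : ℝ≥0∞} (hB : ∀ k, ∫⁻ x, ENNReal.ofReal (‖U k (cellIndex k x)‖ ^ 2) ≤ B) (k : ℤ) (D : ℕ) :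
    ∫⁻ x, ENNReal.ofReal (runMax U k D (cellIndex (k + D) x) ^ 2) ≤ 4 * B := by
  -- With u the current norm and S the running maximum, Z = (2u - S)² + S². It dominates S², starts
  -- at 2u², and its conditional increments are at most four times the variance.
  set Z : ℕ → ℤ → ℝ := fun d n =>
    4 * ‖U (k + d) n‖ ^ 2 - 4 * ‖U (k + d) n‖ * runMax U k d n + 2 * runMax U k d n ^ 2 with hZ
  have hZS : ∀ d n, runMax U k d n ^ 2 ≤ Z d n := fun d n => by
    simp only [hZ]; nlinarith [sq_nonneg (2 * ‖U (k + d) n‖ - runMax U k d n)]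
  -- The maximum may be kept at its old value S: if the new norm v exceeds S, then 2v² ≤ 4v² - 4vS +
  -- 2S², the difference being 2(v - S)².
  have child : ∀ d c, Z (d + 1) c ≤ 4 * ‖U (k + d + 1) c‖ ^ 2 -
      2 * (2 * ‖U (k + d) (c / 2)‖ * runMax U k d (c / 2) - runMax U k d (c / 2) ^ 2 +
        2 * runMax U k d (c / 2) * (‖U (k + d + 1) c‖ - ‖U (k + d) (c / 2)‖)) := by
    intro d c
    have h0 := runMax_nonneg (U := U) k d (c / 2)
    simp only [hZ, runMax, Nat.cast_succ, ← add_assoc]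
    rcases max_cases (runMax U k d (c / 2)) ‖U (k + d + 1) c‖ with ⟨h, h'⟩ | ⟨h, h'⟩ <;> rw [h]
    · nlinarith
    · nlinarith [sq_nonneg (‖U (k + d + 1) c‖ - runMax U k d (c / 2))]
  have key := lintegral_process_le k Z (fun d n => 4 * treeVar U (k + d) n)
    (fun d n => (sq_nonneg _).trans (hZS d n))
    (fun d n => by have := treeVar_nonneg U (k + d) n; positivity)
    (fun d n => by
      have h1 := child d (2 * n)
      have h2 := child d (2 * n + 1)
      rw [show 2 * n / 2 = n by omega] at h1
      rw [show (2 * n + 1) / 2 = n by omega] at h2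
      have h3 := hU.norm_sq_add (k + d) n 0
      simp only [sub_zero] at h3
      -- The norm of a martingale is a submartingale; this controls the term linear in the new norm.
      have h4 : 2 * ‖U (k + d) n‖ ≤ ‖U (k + d + 1) (2 * n)‖ + ‖U (k + d + 1) (2 * n + 1)‖ := by
        refine le_trans (le_of_eq ?_) (norm_add_le _ _)
        rw [hU, ← two_smul ℂ, norm_smul]
        simp
      have h5 := mul_le_mul_of_nonneg_left h4 (runMax_nonneg (U := U) k d n)
      simp only [hZ] at h1 h2 ⊢
      nlinarith) D
  calc ∫⁻ x, ENNReal.ofReal (runMax U k D (cellIndex (k + D) x) ^ 2)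
      ≤ ∫⁻ x, ENNReal.ofReal (Z D (cellIndex (k + D) x)) :=
        lintegral_mono fun x => ENNReal.ofReal_le_ofReal (hZS _ _)
    _ ≤ _ := key
    _ ≤ 4 * ((∫⁻ x, ENNReal.ofReal (‖U k (cellIndex k x)‖ ^ 2)) +
        ∑ d ∈ Finset.range D,
          ∫⁻ x, ENNReal.ofReal (treeVar U (k + d) (cellIndex (k + d) x))) := by
        rw [mul_add, Finset.mul_sum]
        simp_rw [← lintegral_const_mul' 4 _ (by norm_num : (4 : ℝ≥0∞) ≠ ∞)]
        refine add_le_add (lintegral_mono fun x => ?_)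
          (Finset.sum_le_sum fun d _ => lintegral_mono fun x => ?_)
        all_goals
          rw [show (4 : ℝ≥0∞) = ENNReal.ofReal 4 by simp, ← ENNReal.ofReal_mul (by norm_num)]
        refine ENNReal.ofReal_le_ofReal ?_
        simp only [hZ, runMax, Nat.cast_zero, add_zero]
        nlinarith [sq_nonneg ‖U k (cellIndex k x)‖]
    _ ≤ 4 * B := by
        rw [← hU.lintegral_sq]
        gcongr
        exact hB _

theorem tsum_int_le_of_sum_range_le {G : ℤ → ℝ≥0∞} {B : ℝ≥0∞}
    (h : ∀ (k : ℤ) (D : ℕ), ∑ d ∈ Finset.range D, G (k + d) ≤ B) : ∑' k, G k ≤ B := by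
  rw [ENNReal.tsum_eq_iSup_sum]
  refine iSup_le fun s => ?_
  obtain ⟨a, ha⟩ := s.bddBelow
  obtain ⟨b, hb⟩ := s.bddAbove
  refine le_trans ?_ (h a (b + 1 - a).toNat)
  rw [← Finset.sum_image (s := Finset.range (b + 1 - a).toNat) (g := fun d : ℕ => a + (d : ℤ))
    (f := G) (fun x _ y _ hxy => by simpa using hxy)]
  refine Finset.sum_le_sum_of_subset fun k hk => ?_
  have h1 : a ≤ k := ha (by exact_mod_cast hk)
  have h2 : k ≤ b := hb (by exact_mod_cast hk)
  exact Finset.mem_image.2 ⟨(k - a).toNat, Finset.mem_range.2 (by omega), by omega⟩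

theorem IsTreeMartingale.tsum_lintegral_treeVar_le [InnerProductSpace ℂ H] (hU : IsTreeMartingale U)
    {B : ℝ≥0∞} (hB : ∀ k, ∫⁻ x, ENNReal.ofReal (‖U k (cellIndex k x)‖ ^ 2) ≤ B) :
    ∑' k, ∫⁻ x, ENNReal.ofReal (treeVar U k (cellIndex k x)) ≤ B :=
  tsum_int_le_of_sum_range_le fun k D => by
    refine le_trans ?_ (hB (k + D))
    rw [hU.lintegral_sq]
    exact le_add_self

/-! ### Counting jumps -/

open Classical in
/-- While the gate `W` is open, the anchor (first component) stays put until the martingale has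
moved by more than `l`; then it jumps to the new value and the counter (second component)
increases.  While the gate is closed, the anchor follows the martingale at no cost. -/
def jumpState (U : ℤ → ℤ → H) (W : ℤ → ℤ → Prop) (l : ℝ) (k : ℤ) : ℕ → ℤ → H × ℕ
  | 0, n => (U k n, 0)
  | d + 1, n =>
    if W (k + d) (n / 2) then
      if l < ‖U (k + d + 1) n - (jumpState U W l k d (n / 2)).1‖ then
        (U (k + d + 1) n, (jumpState U W l k d (n / 2)).2 + 1)
      else jumpState U W l k d (n / 2)
    else (U (k + d + 1) n, (jumpState U W l k d (n / 2)).2)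

-- The potential l² · counter + ‖U - anchor‖² does not grow at a jump beyond the motion of U: the
-- squared distance lost by resetting the anchor exceeds l². With the gate open its mean increment
-- is therefore at most the variance. With the gate closed the anchor is reset for free and the
-- potential cannot increase.
open Classical in
theorem IsTreeMartingale.lintegral_jumpState_le [InnerProductSpace ℂ H] (hU : IsTreeMartingale U)
    (W : ℤ → ℤ → Prop) {l : ℝ} (hl : 0 ≤ l) (k : ℤ) (D : ℕ) :
    ∫⁻ x, ENNReal.ofReal (l ^ 2 * (jumpState U W l k D (cellIndex (k + D) x)).2) ≤
      ∑ d ∈ Finset.range D, ∫⁻ x, ENNReal.ofReal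
        (if W (k + d) (cellIndex (k + d) x) then treeVar U (k + d) (cellIndex (k + d) x)
          else 0) := by
  set S : ℕ → ℤ → ℝ := fun d n =>
    l ^ 2 * (jumpState U W l k d n).2 + ‖U (k + d) n - (jumpState U W l k d n).1‖ ^ 2 with hS
  have child : ∀ d c, S (d + 1) c ≤ S d (c / 2) + if W (k + d) (c / 2) then
      ‖U (k + d + 1) c - (jumpState U W l k d (c / 2)).1‖ ^ 2 -
        ‖U (k + d) (c / 2) - (jumpState U W l k d (c / 2)).1‖ ^ 2 else 0 := by
    intro d c
    simp only [hS, jumpState, Nat.cast_succ, ← add_assoc]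
    split_ifs with h1 h2
    · simp only [sub_self, norm_zero, Nat.cast_add, Nat.cast_one]
      nlinarith [norm_nonneg (U (k + d + 1) c - (jumpState U W l k d (c / 2)).1)]
    · linarith
    · simp only [sub_self, norm_zero]
      nlinarith [sq_nonneg ‖U (k + d) (c / 2) - (jumpState U W l k d (c / 2)).1‖]
  have key := lintegral_process_le k S
    (fun d n => if W (k + d) n then treeVar U (k + d) n else 0)
    (fun d n => by simp only [hS]; positivity)
    (fun d n => by
      split_ifs
      exacts [treeVar_nonneg _ _ _, le_rfl])
    (fun d n => by
      have h1 := child d (2 * n)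
      have h2 := child d (2 * n + 1)
      rw [show 2 * n / 2 = n by omega] at h1
      rw [show (2 * n + 1) / 2 = n by omega] at h2
      have h3 := hU.norm_sq_add (k + d) n (jumpState U W l k d n).1
      split_ifs at h1 h2 ⊢ <;> linarith) D
  refine (lintegral_mono fun x => ENNReal.ofReal_le_ofReal ?_).trans (key.trans (le_of_eq ?_))
  · simp only [hS]
    exact le_add_of_nonneg_right (sq_nonneg _)
  · simp [hS, jumpState]

theorem jumpState_snd_mono (W : ℤ → ℤ → Prop) (l : ℝ) (k : ℤ) (x : ℝ) :
    Monotone fun d : ℕ => (jumpState U W l k d (cellIndex (k + d) x)).2 := by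
  refine monotone_nat_of_le_succ fun d => ?_
  simp only [jumpState, Nat.cast_succ, ← add_assoc, cellIndex_succ_div]
  split_ifs <;> simp

theorem norm_sub_jumpState_fst_le (W : ℤ → ℤ → Prop) {l : ℝ} (hl : 0 ≤ l) (k : ℤ) (d : ℕ) (n : ℤ) :
    ‖U (k + d) n - (jumpState U W l k d n).1‖ ≤ l := by
  cases d with
  | zero => simpa [jumpState]
  | succ d =>
    simp only [jumpState, Nat.cast_succ, ← add_assoc]
    split_ifs with h1 h2
    · simpa using hl
    · exact not_lt.1 h2
    · simpa using hl

/-- If the gate is closed only at cells where the martingale is small, and never closes again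
above `x`, then the martingale at `x` stays in a number of balls given by the counter. -/
theorem exists_centers_of_jumpState (W : ℤ → ℤ → Prop) {l : ℝ} (hl : 0 ≤ l) (k : ℤ) (x : ℝ)
    (hsmall : ∀ d : ℕ, ¬ W (k + d) (cellIndex (k + d) x) → ‖U (k + d) (cellIndex (k + d) x)‖ ≤ l)
    (hW : ∀ d : ℕ, W (k + d) (cellIndex (k + d) x) → W (k + d + 1) (cellIndex (k + d + 1) x))
    {m : ℕ} (hm : ∀ d : ℕ, (jumpState U W l k d (cellIndex (k + d) x)).2 ≤ m) :
    ∃ c : Fin (m + 2) → H, c 0 = 0 ∧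
      ∀ d : ℕ, ∃ i, ‖U (k + d) (cellIndex (k + d) x) - c i‖ ≤ l := by
  classical
  -- Once open, the gate stays open along the path to `x`, and from then on the anchor changes only
  -- together with the counter. Hence the anchor is a function of the counter.
  have const : ∀ d e : ℕ, d ≤ e → W (k + d) (cellIndex (k + d) x) →
      W (k + e) (cellIndex (k + e) x) ∧ ((jumpState U W l k d (cellIndex (k + d) x)).2 =
        (jumpState U W l k e (cellIndex (k + e) x)).2 →
      (jumpState U W l k d (cellIndex (k + d) x)).1 =
        (jumpState U W l k e (cellIndex (k + e) x)).1) := by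
    intro d e hde hd
    induction e, hde using Nat.le_induction with
    | base => exact ⟨hd, fun _ => rfl⟩
    | succ e hde ih =>
      rw [Nat.cast_succ, ← add_assoc]
      refine ⟨hW e ih.1, fun h => ?_⟩
      have hmono := jumpState_snd_mono (U := U) W l k x hde
      simp only at hmono
      simp only [jumpState, cellIndex_succ_div, ih.1, if_true] at h ⊢
      split_ifs at h ⊢ with h1
      · simp only at h; omega
      · exact ih.2 h
  set P : ℕ → ℕ → Prop := fun i d => W (k + d) (cellIndex (k + d) x) ∧
    (jumpState U W l k d (cellIndex (k + d) x)).2 = i with hP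
  -- There are m + 2 centres: the origin for the closed gate, and one anchor for each counter value
  -- 0, ..., m. Values not attained with the gate open get the dummy centre 0.
  refine ⟨Fin.cons 0 fun i => if h : ∃ d, P i d then
    (jumpState U W l k h.choose (cellIndex (k + h.choose) x)).1 else 0, Fin.cons_zero _ _, fun d => ?_⟩
  by_cases hd : W (k + d) (cellIndex (k + d) x)
  · refine ⟨Fin.succ ⟨_, Nat.lt_succ_of_le (hm d)⟩, ?_⟩
    have hex : ∃ e, P (jumpState U W l k d (cellIndex (k + d) x)).2 e := ⟨d, hd, rfl⟩
    rw [Fin.cons_succ, dif_pos hex]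
    have hs := hex.choose_spec
    have : (jumpState U W l k hex.choose (cellIndex (k + hex.choose) x)).1 =
        (jumpState U W l k d (cellIndex (k + d) x)).1 := by
      rcases le_total hex.choose d with h | h
      · exact (const _ _ h hs.1).2 hs.2
      · exact ((const _ _ h hd).2 hs.2.symm).symm
    rw [this]
    exact norm_sub_jumpState_fst_le W hl k d _
  · exact ⟨0, by simpa using hsmall d hd⟩

end TreeMartingale

/-! ### Jumps of a tree martingale at all dyadic heights -/

theorem two_zpow_eq_ofReal (j : ℤ) : (2 : ℝ≥0∞) ^ j = ENNReal.ofReal (2 ^ j) := by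
  cases j with
  | ofNat n => simp [ENNReal.ofReal_pow]
  | negSucc n =>
    rw [zpow_negSucc, zpow_negSucc, ENNReal.ofReal_inv_of_pos (by positivity),
      ENNReal.ofReal_pow (by norm_num), ENNReal.ofReal_ofNat]

theorem two_zpow_ne_top (j : ℤ) : (2 : ℝ≥0∞) ^ j ≠ ∞ := by
  rw [two_zpow_eq_ofReal]; exact ENNReal.ofReal_ne_top

theorem two_zpow_ne_zero (j : ℤ) : (2 : ℝ≥0∞) ^ j ≠ 0 := by
  rw [two_zpow_eq_ofReal]; simp; positivity

theorem two_zpow_strictMono : StrictMono fun j : ℤ => (2 : ℝ≥0∞) ^ j := by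
  intro i j hij
  simp only [two_zpow_eq_ofReal]
  exact (ENNReal.ofReal_lt_ofReal_iff (by positivity)).2 (zpow_lt_zpow_right₀ (by norm_num) hij)

-- If 2^J < R ≤ 2^(J+1), the condition forces J - m < j ≤ J, which leaves m heights. This is where
-- the factor m in the jump count is born.
open Classical in
theorem tsum_indicator_dyadic_le (R : ℝ≥0∞) (m : ℕ) (a : ℝ≥0∞) :
    ∑' j : ℤ, (if (2 : ℝ≥0∞) ^ j < R ∧ R ≤ 2 ^ (j + m) then a else 0) ≤ m * a := by
  by_cases hR : R = 0 ∨ R = ∞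
  · have : ∀ j : ℤ, ¬ ((2 : ℝ≥0∞) ^ j < R ∧ R ≤ 2 ^ (j + m)) := by
      rintro j ⟨h1, h2⟩
      rcases hR with rfl | rfl
      · exact not_lt_zero h1
      · exact two_zpow_ne_top _ (top_le_iff.1 h2)
    simp [this]
  push Not at hR
  obtain ⟨J, hJ1, hJ2⟩ := ENNReal.exists_mem_Ioc_zpow hR.1 hR.2 (y := 2) (by norm_num) (by norm_num)
  have hsub : ∀ j ∉ Finset.Ioc (J - m) J,
      (if (2 : ℝ≥0∞) ^ j < R ∧ R ≤ 2 ^ (j + m) then a else 0) = 0 := by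
    intro j hj
    refine if_neg fun ⟨h1, h2⟩ => hj ?_
    have h3 := two_zpow_strictMono.lt_iff_lt.1 (h1.trans_le hJ2)
    have h4 := two_zpow_strictMono.lt_iff_lt.1 (hJ1.trans_le h2)
    rw [Finset.mem_Ioc]
    omega
  rw [tsum_eq_sum hsub]
  refine (Finset.sum_le_card_nsmul _ _ a fun j _ => by split_ifs <;> simp).trans ?_
  simp

section Heights

variable {H : Type*} [NormedAddCommGroup H]

/-- The maximum of `‖U‖` over all dyadic cells containing a given cell. -/
def ancestorMax (U : ℤ → ℤ → H) (k n : ℤ) : ℝ≥0∞ := ⨆ i : ℕ, ‖U (k - i) (n / 2 ^ i)‖ₑ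

/-- The maximum of `‖U‖` over all dyadic cells containing a given point. -/
def treeMax (U : ℤ → ℤ → H) (x : ℝ) : ℝ≥0∞ := ⨆ k : ℤ, ‖U k (cellIndex k x)‖ₑ

variable (U : ℤ → ℤ → H)

theorem enorm_le_ancestorMax (k n : ℤ) : ‖U k n‖ₑ ≤ ancestorMax U k n :=
  le_iSup_of_le 0 (by simp)

theorem ancestorMax_le_succ (k c : ℤ) : ancestorMax U k (c / 2) ≤ ancestorMax U (k + 1) c := by
  refine iSup_le fun i => ?_
  refine le_iSup_of_le (i + 1) (le_of_eq ?_)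
  rw [Int.ediv_ediv_of_nonneg (by norm_num), pow_succ', show k + 1 - ((i + 1 : ℕ) : ℤ) = k - i by
    push_cast; ring]

theorem cellIndex_div_pow (k : ℤ) (x : ℝ) (i : ℕ) :
    cellIndex k x / 2 ^ i = cellIndex (k - i) x := by
  induction i with
  | zero => simp
  | succ i ih =>
    rw [pow_add, ← Int.ediv_ediv_of_nonneg (by positivity), ih, pow_one,
      ← cellIndex_succ_div (k - (i + 1 : ℕ)), show k - ((i + 1 : ℕ) : ℤ) + 1 = k - i by
        push_cast; ring]

theorem ancestorMax_le_treeMax (k : ℤ) (x : ℝ) :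
    ancestorMax U k (cellIndex k x) ≤ treeMax U x := by
  refine iSup_le fun i => ?_
  rw [cellIndex_div_pow]
  exact le_iSup (fun k : ℤ => ‖U k (cellIndex k x)‖ₑ) _

/-- The cells at which jumps of size `2 ^ j` are counted. -/
def heightGate (j : ℤ) (m : ℕ) (k n : ℤ) : Prop :=
  (2 : ℝ≥0∞) ^ j < ancestorMax U k n ∧ ancestorMax U k n ≤ 2 ^ (j + m)

theorem measurable_treeMax : Measurable (treeMax U) :=
  Measurable.iSup fun k => measurable_comp_cellIndex k fun n => ‖U k n‖ₑ

variable {U}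

theorem enorm_sq_eq_ofReal (a : H) : ‖a‖ₑ ^ 2 = ENNReal.ofReal (‖a‖ ^ 2) := by
  rw [ENNReal.ofReal_pow (norm_nonneg _), ofReal_norm]

/-- Doob's constant does not depend on the window of levels -m, ..., m, so monotone convergence
removes the window. -/
theorem IsTreeMartingale.lintegral_treeMax_sq_le [InnerProductSpace ℂ H] (hU : IsTreeMartingale U)
    {B : ℝ≥0∞} (hB : ∀ k, ∫⁻ x, ENNReal.ofReal (‖U k (cellIndex k x)‖ ^ 2) ≤ B) :
    ∫⁻ x, treeMax U x ^ 2 ≤ 4 * B := by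
  set G : ℕ → ℝ → ℝ≥0∞ := fun m x =>
    (⨆ k ∈ Finset.Icc (-(m : ℤ)) m, ‖U k (cellIndex k x)‖ₑ) ^ 2 with hG
  have h1 : ∀ x, treeMax U x ^ 2 ≤ ⨆ m, G m x := by
    intro x
    rw [treeMax, ENNReal.iSup_pow_of_ne_zero two_ne_zero]
    refine iSup_le fun k => le_iSup_of_le k.natAbs ?_
    simp only [hG]
    gcongr
    exact le_iSup₂_of_le k (Finset.mem_Icc.2 ⟨by omega, by omega⟩) le_rfl
  refine (lintegral_mono h1).trans ?_
  rw [lintegral_iSup]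
  · refine iSup_le fun m => ?_
    refine le_trans (lintegral_mono fun x => ?_) (hU.lintegral_runMax_sq_le hB (-(m : ℤ)) (2 * m))
    rw [ENNReal.ofReal_pow (runMax_nonneg _ _ _)]
    simp only [hG]
    gcongr
    refine iSup₂_le fun k hk => ?_
    rw [Finset.mem_Icc] at hk
    obtain ⟨i, rfl⟩ : ∃ i : ℕ, k = -(m : ℤ) + i := ⟨(k + m).toNat, by omega⟩
    rw [← ofReal_norm]
    exact ENNReal.ofReal_le_ofReal (le_runMax _ (by omega) x)
  · intro m
    refine Measurable.pow_const (Measurable.iSup fun k => Measurable.iSup fun _ => ?_) _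
    exact measurable_comp_cellIndex k fun n => ‖U k n‖ₑ
  · intro m m' hm x
    simp only [hG]
    refine pow_le_pow_left' (iSup₂_le fun k hk => ?_) 2
    have hk' : k ∈ Finset.Icc (-(m' : ℤ)) m' := by
      rw [Finset.mem_Icc] at hk ⊢
      omega
    exact le_iSup₂_of_le k hk' le_rfl

/-- A value v on one cell of length 2^(-k) already contributes ‖v‖² 2^(-k) to an integral bounded by
B, so v is small on long cells, uniformly in their position. Jump counting at height 2^j can start
at such a level, since everything coarser lies in the ball about 0. -/
theorem exists_coarse_level {B : ℝ≥0∞}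
    (hB : ∀ k, ∫⁻ x, ENNReal.ofReal (‖U k (cellIndex k x)‖ ^ 2) ≤ B)
    (hB' : B ≠ ∞) (j : ℤ) : ∃ k₀, ∀ k ≤ k₀, ∀ n, ‖U k n‖ₑ ≤ 2 ^ j := by
  obtain ⟨m, hm⟩ := exists_nat_gt (B.toReal / (2 ^ j) ^ 2)
  refine ⟨-m, fun k hk n => ?_⟩
  have h1 := hB k
  rw [lintegral_cellIndex k (fun n => ENNReal.ofReal (‖U k n‖ ^ 2))] at h1
  have h2 := (mul_le_mul_left (ENNReal.le_tsum n) _).trans h1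
  rw [← ENNReal.ofReal_mul (by positivity), ENNReal.ofReal_le_iff_le_toReal hB'] at h2
  have h3 : (m : ℝ) ≤ 2 ^ (-k) := by
    obtain ⟨i, rfl⟩ : ∃ i : ℕ, k = -(i : ℤ) := ⟨(-k).toNat, by omega⟩
    rw [neg_neg, zpow_natCast]
    have : m ≤ i := by omega
    exact_mod_cast this.trans Nat.lt_two_pow_self.le
  rw [div_lt_iff₀ (by positivity)] at hm
  have h4 : ‖U k n‖ ^ 2 * m ≤ m * (2 ^ j) ^ 2 :=
    (mul_le_mul_of_nonneg_left h3 (by positivity)).trans (h2.trans hm.le)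
  rw [two_zpow_eq_ofReal, ← ofReal_norm]
  refine ENNReal.ofReal_le_ofReal ?_
  rcases Nat.eq_zero_or_pos m with rfl | hm0
  · have : B.toReal < 0 := by simpa using hm
    exact absurd this (not_lt.2 ENNReal.toReal_nonneg)
  · have hm' : (0 : ℝ) < m := by exact_mod_cast hm0
    refine le_of_sq_le_sq ?_ (by positivity)
    nlinarith

/-- The number of jumps of size `2 ^ j` above `x`, counted from level `k`. -/
def jumpCount (U : ℤ → ℤ → H) (j : ℤ) (m : ℕ) (k : ℤ) (x : ℝ) : ℝ≥0∞ :=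
  ⨆ d : ℕ, ((jumpState U (heightGate U j m) (2 ^ j) k d (cellIndex (k + d) x)).2 : ℝ≥0∞)

theorem measurable_jumpCount (j : ℤ) (m : ℕ) (k : ℤ) : Measurable (jumpCount U j m k) :=
  Measurable.iSup fun d => measurable_comp_cellIndex (k + d) fun n =>
    ((jumpState U (heightGate U j m) (2 ^ j) k d n).2 : ℝ≥0∞)

/-- For each height the jumps are paid for by the variance on the cells where that gate is open.
Exchanging the sums over heights and levels, each cell is used at most m times, and the total
variance is at most B. The starting levels `k₀ j` may vary with the height because the variance is
summed over all levels. -/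
theorem IsTreeMartingale.lintegral_tsum_jumpCount_le [InnerProductSpace ℂ H]
    (hU : IsTreeMartingale U) {B : ℝ≥0∞}
    (hB : ∀ k, ∫⁻ x, ENNReal.ofReal (‖U k (cellIndex k x)‖ ^ 2) ≤ B) (k₀ : ℤ → ℤ) (m : ℕ) :
    ∫⁻ x, ∑' j, ((2 : ℝ≥0∞) ^ j) ^ 2 * jumpCount U j m (k₀ j) x ≤ m * B := by
  classical
  rw [lintegral_tsum fun j => ((measurable_jumpCount j m (k₀ j)).const_mul _).aemeasurable]
  have h1 : ∀ j : ℤ, ∫⁻ x, ((2 : ℝ≥0∞) ^ j) ^ 2 * jumpCount U j m (k₀ j) x ≤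
      ∑' k, ∫⁻ x, if heightGate U j m k (cellIndex k x) then
        ENNReal.ofReal (treeVar U k (cellIndex k x)) else 0 := by
    intro j
    simp only [jumpCount, ENNReal.mul_iSup]
    rw [lintegral_iSup]
    · refine iSup_le fun D => ?_
      have := hU.lintegral_jumpState_le (heightGate U j m) (l := 2 ^ j) (by positivity) (k₀ j) D
      calc _ = ∫⁻ x, ENNReal.ofReal ((2 ^ j) ^ 2 *
          (jumpState U (heightGate U j m) (2 ^ j) (k₀ j) D (cellIndex (k₀ j + D) x)).2) := by
            refine lintegral_congr fun x => ?_
            rw [ENNReal.ofReal_mul (by positivity), ENNReal.ofReal_natCast,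
              ENNReal.ofReal_pow (by positivity), two_zpow_eq_ofReal]
        _ ≤ _ := this
        _ = ∑ d ∈ Finset.range D, ∫⁻ x, if heightGate U j m (k₀ j + d) (cellIndex (k₀ j + d) x) then
            ENNReal.ofReal (treeVar U (k₀ j + d) (cellIndex (k₀ j + d) x)) else 0 := by
            refine Finset.sum_congr rfl fun d _ => lintegral_congr fun x => ?_
            split_ifs <;> simp
        _ ≤ _ := by
            rw [← Finset.sum_image (s := Finset.range D) (g := fun d : ℕ => k₀ j + (d : ℤ))
              (f := fun k => ∫⁻ x, if heightGate U j m k (cellIndex k x) then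
                ENNReal.ofReal (treeVar U k (cellIndex k x)) else 0)
              (fun x _ y _ hxy => by simpa using hxy)]
            exact ENNReal.sum_le_tsum _
    · exact fun D => measurable_comp_cellIndex (k₀ j + D) fun n => ((2 : ℝ≥0∞) ^ j) ^ 2 *
        ((jumpState U (heightGate U j m) (2 ^ j) (k₀ j) D n).2 : ℝ≥0∞)
    · intro D D' hD x
      dsimp only
      gcongr
      exact jumpState_snd_mono _ _ _ x hD
  refine (ENNReal.tsum_le_tsum h1).trans ?_
  rw [ENNReal.tsum_comm]
  calc _ = ∑' k : ℤ, ∫⁻ x, ∑' j : ℤ, if heightGate U j m k (cellIndex k x) then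
        ENNReal.ofReal (treeVar U k (cellIndex k x)) else 0 := by
        refine tsum_congr fun k => ?_
        rw [lintegral_tsum fun j => (measurable_comp_cellIndex k fun n =>
          if heightGate U j m k n then ENNReal.ofReal (treeVar U k n) else 0).aemeasurable]
    _ ≤ ∑' k : ℤ, ∫⁻ x, m * ENNReal.ofReal (treeVar U k (cellIndex k x)) :=
        ENNReal.tsum_le_tsum fun k => lintegral_mono fun x => by
          convert tsum_indicator_dyadic_le (ancestorMax U k (cellIndex k x)) m
            (ENNReal.ofReal (treeVar U k (cellIndex k x))) using 3
          exact if_congr Iff.rfl rfl rfl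
    _ ≤ m * B := by
        simp_rw [lintegral_const_mul' _ _ (ENNReal.natCast_ne_top m), ENNReal.tsum_mul_left]
        gcongr
        exact hU.tsum_lintegral_treeVar_le hB

/-- Under `hx` the upper half of the gate condition always holds above `x`, so a closed gate means
that the running maximum is still at most 2^j. That maximum grows towards finer cells, so the gate
never closes again. -/
theorem exists_centers_of_jumpCount {j : ℤ} {m : ℕ} {k₀ : ℤ}
    (hk₀ : ∀ k ≤ k₀, ∀ n, ‖U k n‖ₑ ≤ 2 ^ j) {x : ℝ} (hx : treeMax U x ≤ 2 ^ (j + m)) {N : ℕ}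
    (hN : jumpCount U j m k₀ x ≤ N) :
    ∃ c : Fin (N + 2) → H, ∀ k : ℤ, ∃ i, ‖U k (cellIndex k x) - c i‖ ≤ 2 ^ j := by
  have toReal : ∀ k n, ‖U k n‖ₑ ≤ 2 ^ j → ‖U k n‖ ≤ 2 ^ j := fun k n h => by
    rw [two_zpow_eq_ofReal, ← ofReal_norm] at h
    exact (ENNReal.ofReal_le_ofReal_iff (by positivity)).1 h
  obtain ⟨c, hc0, hc⟩ := exists_centers_of_jumpState (U := U) (heightGate U j m) (l := 2 ^ j)
    (by positivity) k₀ x (m := N)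
    (fun d hd => toReal _ _ <| by
      refine (enorm_le_ancestorMax U _ _).trans ?_
      by_contra! h
      exact hd ⟨h, (ancestorMax_le_treeMax U _ x).trans hx⟩)
    (fun d hd => ⟨hd.1.trans_le (by
      rw [← cellIndex_succ_div]; exact ancestorMax_le_succ U _ _),
      (ancestorMax_le_treeMax U _ x).trans hx⟩)
    (fun d => by
      have := (le_iSup (fun d : ℕ => ((jumpState U (heightGate U j m) (2 ^ j) k₀ d
        (cellIndex (k₀ + d) x)).2 : ℝ≥0∞)) d).trans hN
      exact_mod_cast this)
  refine ⟨c, fun k => ?_⟩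
  rcases le_total k k₀ with hk | hk
  · exact ⟨0, by rw [hc0, sub_zero]; exact toReal _ _ (hk₀ k hk _)⟩
  · obtain ⟨d, rfl⟩ : ∃ d : ℕ, k = k₀ + d := ⟨(k - k₀).toNat, by omega⟩
    exact hc d

end Heights

/-! ### Integral inequalities -/

theorem lintegral_mul_sq_le {α : Type*} [MeasurableSpace α] {μ : Measure α} {w h : α → ℝ≥0∞}
    (hw : AEMeasurable w μ) (hh : AEMeasurable h μ) :
    (∫⁻ x, w x * h x ∂μ) ^ 2 ≤ (∫⁻ x, w x ∂μ) * ∫⁻ x, w x * h x ^ 2 ∂μ := by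
  have key := ENNReal.lintegral_mul_le_Lp_mul_Lq μ Real.HolderConjugate.two_two
    (hw.pow_const (1 / 2 : ℝ)) ((hw.pow_const (1 / 2 : ℝ)).mul hh)
  have h1 : ∀ x, w x ^ (1 / 2 : ℝ) * w x ^ (1 / 2 : ℝ) = w x := fun x => by
    rw [← ENNReal.rpow_add_of_nonneg _ _ (by norm_num) (by norm_num)]; norm_num
  have h2 : ∀ x, (w x ^ (1 / 2 : ℝ)) ^ (2 : ℝ) = w x := fun x => by
    rw [← ENNReal.rpow_mul]; norm_num
  simp only [Pi.mul_apply, ← mul_assoc, h1, h2, ENNReal.mul_rpow_of_nonneg _ _ zero_le_two] at key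
  calc _ ≤ ((∫⁻ x, w x ∂μ) ^ (1 / 2 : ℝ) * (∫⁻ x, w x * h x ^ (2 : ℝ) ∂μ) ^ (1 / 2 : ℝ)) ^ 2 :=
        pow_le_pow_left' key 2
    _ = _ := by
        rw [mul_pow, ← ENNReal.rpow_natCast, ← ENNReal.rpow_natCast, ← ENNReal.rpow_mul,
          ← ENNReal.rpow_mul]
        norm_num

theorem tsum_mul_sq_le {ι : Type*} (w h : ι → ℝ≥0∞) :
    (∑' i, w i * h i) ^ 2 ≤ (∑' i, w i) * ∑' i, w i * h i ^ 2 := by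
  let _ : MeasurableSpace ι := ⊤
  simp only [← lintegral_count]
  exact lintegral_mul_sq_le (measurable_from_top).aemeasurable (measurable_from_top).aemeasurable

theorem lintegral_comp_div {P : ℝ → ℝ≥0∞} (hP : Measurable P) {t : ℝ} (ht : 0 < t) :
    ∫⁻ x, P (x / t) = ENNReal.ofReal t * ∫⁻ x, P x := by
  have h := Real.smul_map_volume_mul_left (inv_ne_zero ht.ne')
  rw [abs_of_pos (inv_pos.2 ht)] at h
  conv_rhs => rw [← h]
  rw [lintegral_smul_measure, lintegral_map hP (measurable_const_mul _), smul_eq_mul, ← mul_assoc,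
    ← ENNReal.ofReal_mul ht.le, mul_inv_cancel₀ ht.ne', ENNReal.ofReal_one, one_mul]
  simp only [div_eq_inv_mul]

/-- Young's inequality `‖P * h‖₂ ≤ ‖P‖₁ ‖h‖₂`. -/
theorem lintegral_convolution_sq_le {P h : ℝ → ℝ≥0∞} (hP : Measurable P) (hh : Measurable h) :
    ∫⁻ x, (∫⁻ y, P (x - y) * h y) ^ 2 ≤ (∫⁻ x, P x) ^ 2 * ∫⁻ x, h x ^ 2 := by
  calc ∫⁻ x, (∫⁻ y, P (x - y) * h y) ^ 2
      ≤ ∫⁻ x, (∫⁻ y, P y) * ∫⁻ y, P (x - y) * h y ^ 2 := by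
        refine lintegral_mono fun x => ?_
        refine (lintegral_mul_sq_le (by fun_prop) (by fun_prop)).trans (le_of_eq ?_)
        rw [lintegral_sub_left_eq_self (fun y => P y) x]
    _ = (∫⁻ y, P y) * ∫⁻ y, ∫⁻ x, P (x - y) * h y ^ 2 := by
        rw [lintegral_const_mul _ (by fun_prop), lintegral_lintegral_swap (by fun_prop)]
    _ = _ := by
        have h1 : ∀ y, ∫⁻ x, P (x - y) * h y ^ 2 = (∫⁻ x, P x) * h y ^ 2 := fun y => by
          rw [lintegral_mul_const _ (by fun_prop), lintegral_sub_right_eq_self P y]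
        simp_rw [h1]
        rw [lintegral_const_mul _ (by fun_prop), ← mul_assoc, sq]

/-! ### Averages over dyadic cells -/

section Averages

variable {H : Type*} [NormedAddCommGroup H] [InnerProductSpace ℂ H]

/-- The mean value of `f` on a dyadic cell. -/
def cellAverage (f : ℝ → H) (k n : ℤ) : H := (2 : ℝ) ^ k • ∫ y in cell k n, f y

instance isFiniteMeasure_restrict_cell (k n : ℤ) : IsFiniteMeasure (volume.restrict (cell k n)) :=
  ⟨by rw [Measure.restrict_apply_univ, volume_cell]; exact ENNReal.ofReal_lt_top⟩

theorem integrableOn_cell_of_memLp {H : Type*} [NormedAddCommGroup H] {f : ℝ → H}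
    (hf : MemLp f 2 volume) (k n : ℤ) :
    IntegrableOn f (cell k n) :=
  (hf.restrict _).integrable one_le_two

theorem isTreeMartingale_cellAverage {f : ℝ → H} (hf : MemLp f 2 volume) :
    IsTreeMartingale (cellAverage f) := by
  intro k n
  have h2 : (2 : ℝ) ^ (k + 1) = 2 ^ k + 2 ^ k := by rw [zpow_add_one₀ (by norm_num)]; ring
  rw [cellAverage, cellAverage, cellAverage, ← smul_add, cell_eq_union k n,
    setIntegral_union (disjoint_children k n) (measurableSet_cell _ _) (integrableOn_cell_of_memLp hf _ _)
      (integrableOn_cell_of_memLp hf _ _), h2, add_smul]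

theorem enorm_cellAverage_sq_le {f : ℝ → H} (hf : MemLp f 2 volume) (k n : ℤ) :
    ‖cellAverage f k n‖ₑ ^ 2 ≤ ENNReal.ofReal (2 ^ k) * ∫⁻ y in cell k n, ‖f y‖ₑ ^ 2 := by
  have h2 : ‖(2 : ℝ) ^ k‖ₑ = ENNReal.ofReal (2 ^ k) :=
    Real.enorm_of_nonneg (by positivity)
  have h1 := lintegral_mul_sq_le (μ := volume.restrict (cell k n)) (w := fun _ => 1)
    (h := fun y => ‖f y‖ₑ) aemeasurable_const hf.1.enorm.restrict
  simp only [one_mul, lintegral_const, Measure.restrict_apply_univ, volume_cell] at h1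
  rw [cellAverage, enorm_smul, mul_pow, h2]
  calc _ ≤ ENNReal.ofReal (2 ^ k) ^ 2 *
        (ENNReal.ofReal (2 ^ (-k)) * ∫⁻ y in cell k n, ‖f y‖ₑ ^ 2) := by
        gcongr
        exact (pow_le_pow_left' (enorm_integral_le_lintegral_enorm _) 2).trans h1
    _ = _ := by
        rw [← mul_assoc, sq, mul_assoc (ENNReal.ofReal _), ← ENNReal.ofReal_mul (by positivity),
          ← zpow_add₀ (by norm_num)]
        simp

theorem lintegral_cellAverage_sq_le {f : ℝ → H} (hf : MemLp f 2 volume) (k : ℤ) :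
    ∫⁻ x, ‖cellAverage f k (cellIndex k x)‖ₑ ^ 2 ≤ ∫⁻ x, ‖f x‖ₑ ^ 2 := by
  rw [lintegral_cellIndex k (fun n => ‖cellAverage f k n‖ₑ ^ 2), lintegral_eq_tsum_cell k,
    ← ENNReal.tsum_mul_right]
  refine ENNReal.tsum_le_tsum fun n => ?_
  refine (mul_le_mul_left (enorm_cellAverage_sq_le hf k n) _).trans (le_of_eq ?_)
  rw [mul_right_comm, ← ENNReal.ofReal_mul (by positivity), ← zpow_add₀ (by norm_num)]
  simp

end Averages

/-! ### Kernels -/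

theorem one_add_sq_mul_le_of_decay {F : Type*} [NormedAddCommGroup F] [NormedSpace ℝ F]
    (K : 𝓢(ℝ, F)) : ∃ B : ℝ, 0 < B ∧ ∀ z, ‖K z‖ ≤ B * (1 + z ^ 2)⁻¹ := by
  obtain ⟨C₀, h₀, hC₀⟩ := K.decay 0 0
  obtain ⟨C₂, h₂, hC₂⟩ := K.decay 2 0
  refine ⟨C₀ + C₂, by positivity, fun z => ?_⟩
  have h1 := hC₀ z
  have h2 := hC₂ z
  simp only [norm_iteratedFDeriv_zero, pow_zero, one_mul, Real.norm_eq_abs, sq_abs] at h1 h2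
  rw [← div_eq_mul_inv, le_div_iff₀ (by positivity)]
  linarith

/-- The quantitative information on a kernel that is used below. -/
structure KernelBound (K : 𝓢(ℝ, ℂ)) (B : ℝ) : Prop where
  pos : 0 < B
  norm_le : ∀ z, ‖K z‖ ≤ B * (1 + z ^ 2)⁻¹
  norm_sub_le : ∀ z w, |z - w| ≤ 1 → ‖K z - K w‖ ≤ B * |z - w| * (1 + z ^ 2)⁻¹

theorem exists_kernelBound (K : 𝓢(ℝ, ℂ)) : ∃ B, KernelBound K B := by
  obtain ⟨B₀, h₀, hB₀⟩ := one_add_sq_mul_le_of_decay K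
  obtain ⟨B₁, h₁, hB₁⟩ := one_add_sq_mul_le_of_decay (SchwartzMap.derivCLM ℂ ℂ K)
  refine ⟨B₀ + 3 * B₁, by positivity, fun z => (hB₀ z).trans ?_, fun z w hzw => ?_⟩
  · gcongr; linarith
  · have hbound : ∀ v ∈ uIcc w z, ‖deriv K v‖ ≤ 3 * B₁ * (1 + z ^ 2)⁻¹ := by
      intro v hv
      have hv1 : |z - v| ≤ 1 :=
        (abs_sub_le_of_uIcc_subset_uIcc (uIcc_subset_uIcc_right hv)).trans hzw
      have h := hB₁ v
      rw [SchwartzMap.derivCLM_apply] at h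
      refine h.trans ?_
      rw [mul_comm 3, mul_assoc]
      gcongr
      -- The factor 3 is 1 + z² ≤ 3 (1 + v²) for |z - v| ≤ 1.
      rw [← div_eq_mul_inv, le_div_iff₀ (by positivity), inv_mul_le_iff₀ (by positivity)]
      have := (abs_le.1 hv1)
      nlinarith [sq_nonneg (z - 2 * v), mul_nonneg (sub_nonneg.2 this.1) (sub_nonneg.2 this.2)]
    have := Convex.norm_image_sub_le_of_norm_hasDerivWithin_le
      (fun v _ => (K.hasDerivAt v).hasDerivWithinAt) hbound (convex_uIcc w z) left_mem_uIcc
      right_mem_uIcc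
    refine this.trans ?_
    rw [Real.norm_eq_abs]
    have h3 : 0 ≤ (1 + z ^ 2)⁻¹ := by positivity
    have h4 := abs_nonneg (z - w)
    nlinarith [mul_nonneg h₀.le (mul_nonneg h3 h4)]

theorem continuous_dilate (K : 𝓢(ℝ, ℂ)) (t : ℝ) : Continuous (dilate K t) := by
  unfold dilate
  have := K.continuous
  fun_prop

theorem norm_dilate (K : 𝓢(ℝ, ℂ)) {t : ℝ} (ht : 0 < t) (x : ℝ) :
    ‖dilate K t x‖ = t⁻¹ * ‖K (x / t)‖ := by
  simp [dilate, abs_of_pos ht]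

/-- The dilated majorant of a kernel. -/
def cauchyMajorant (t x : ℝ) : ℝ := t⁻¹ * (1 + (x / t) ^ 2)⁻¹

theorem cauchyMajorant_nonneg {t : ℝ} (ht : 0 < t) (x : ℝ) : 0 ≤ cauchyMajorant t x := by
  unfold cauchyMajorant; positivity

theorem continuous_cauchyMajorant (t : ℝ) : Continuous (cauchyMajorant t) := by
  unfold cauchyMajorant
  refine continuous_const.mul (Continuous.inv₀ (by fun_prop) fun x => by positivity)

theorem lintegral_cauchyMajorant {t : ℝ} (ht : 0 < t) :
    ∫⁻ x, ENNReal.ofReal (cauchyMajorant t x) = ENNReal.ofReal Real.pi := by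
  simp only [cauchyMajorant]
  simp_rw [ENNReal.ofReal_mul (inv_nonneg.2 ht.le)]
  have hm : Measurable fun x : ℝ => ENNReal.ofReal (1 + x ^ 2)⁻¹ := by fun_prop
  rw [lintegral_const_mul' _ _ ENNReal.ofReal_ne_top, lintegral_comp_div hm ht, ← mul_assoc,
    ← ENNReal.ofReal_mul (by positivity), inv_mul_cancel₀ ht.ne', ENNReal.ofReal_one, one_mul,
    ← ofReal_integral_eq_lintegral_ofReal integrable_inv_one_add_sq
      (.of_forall fun x => by positivity), integral_univ_inv_one_add_sq]

theorem KernelBound.norm_dilate_le {K : 𝓢(ℝ, ℂ)} {B : ℝ} (hK : KernelBound K B) {t : ℝ}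
    (ht : 0 < t) (x : ℝ) : ‖dilate K t x‖ ≤ B * cauchyMajorant t x := by
  rw [norm_dilate K ht, cauchyMajorant, mul_left_comm]
  gcongr
  exact hK.norm_le _

theorem KernelBound.norm_dilate_sub_le {K : 𝓢(ℝ, ℂ)} {B : ℝ} (hK : KernelBound K B) {t : ℝ}
    (ht : 0 < t) (x y : ℝ) (hxy : |x - y| ≤ t) :
    ‖dilate K t x - dilate K t y‖ ≤ B * (|x - y| / t) * cauchyMajorant t x := by
  have h1 : |x / t - y / t| = |x - y| / t := by rw [← sub_div, abs_div, abs_of_pos ht]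
  have h2 := hK.norm_sub_le (x / t) (y / t) (by rw [h1]; exact (div_le_one ht).2 hxy)
  rw [dilate, dilate, ← mul_sub, norm_mul, norm_inv, Complex.norm_real, Real.norm_of_nonneg ht.le,
    cauchyMajorant, mul_left_comm, ← h1]
  gcongr

/-! ### Convolution of Hilbert-space-valued functions with a dilated kernel -/

section Smear

variable {H : Type*} [NormedAddCommGroup H] [InnerProductSpace ℂ H]

/-- The convolution of a vector-valued function with a dilated kernel. -/
def smear (K : 𝓢(ℝ, ℂ)) (t : ℝ) (f : ℝ → H) (x : ℝ) : H := ∫ y, dilate K t (x - y) • f y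

theorem integrable_cauchyMajorant {t : ℝ} (ht : 0 < t) : Integrable (cauchyMajorant t) :=
  (integrable_inv_one_add_sq.comp_div ht.ne').const_mul _

theorem cauchyMajorant_le {t : ℝ} (ht : 0 < t) (x : ℝ) : cauchyMajorant t x ≤ t⁻¹ := by
  unfold cauchyMajorant
  refine mul_le_of_le_one_right (by positivity) (inv_le_one_of_one_le₀ ?_)
  nlinarith [sq_nonneg (x / t)]

theorem integrable_cauchyMajorant_mul {H : Type*} [NormedAddCommGroup H] {f : ℝ → H}
    (hf : MemLp f 2 volume) {t : ℝ} (ht : 0 < t) (x : ℝ) :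
    Integrable fun y => cauchyMajorant t (x - y) * ‖f y‖ := by
  have h1 := ((integrable_cauchyMajorant ht).comp_sub_left x).const_mul t⁻¹
  refine (h1.add ((memLp_two_iff_integrable_sq_norm hf.1).1 hf)).mono'
    (((continuous_cauchyMajorant t).comp (by fun_prop)).aestronglyMeasurable.mul hf.1.norm)
    (.of_forall fun y => ?_)
  have h2 := cauchyMajorant_nonneg ht (x - y)
  rw [Real.norm_of_nonneg (by positivity)]
  simp only [Pi.add_apply]
  nlinarith [mul_le_mul_of_nonneg_right (cauchyMajorant_le ht (x - y)) h2,
    sq_nonneg (cauchyMajorant t (x - y) - ‖f y‖), sq_nonneg ‖f y‖]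

variable {K : 𝓢(ℝ, ℂ)} {B : ℝ}

theorem KernelBound.integrable_dilate_smul (hK : KernelBound K B) {f : ℝ → H}
    (hf : MemLp f 2 volume) {t : ℝ} (ht : 0 < t) (x : ℝ) :
    Integrable fun y => dilate K t (x - y) • f y := by
  refine ((integrable_cauchyMajorant_mul hf ht x).const_mul B).mono'
    (((continuous_dilate K t).comp (by fun_prop)).aestronglyMeasurable.smul hf.1)
    (.of_forall fun y => ?_)
  rw [norm_smul, ← mul_assoc]
  gcongr
  exact hK.norm_dilate_le ht _

theorem stronglyMeasurable_smear (K : 𝓢(ℝ, ℂ)) {f : ℝ → H} (hf : StronglyMeasurable f) :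
    StronglyMeasurable fun p : ℝ × ℝ => smear K p.1 f p.2 := by
  refine StronglyMeasurable.integral_prod_right (f := fun (p : ℝ × ℝ) y =>
    dilate K p.1 (p.2 - y) • f y) ?_
  have h1 : Measurable fun q : (ℝ × ℝ) × ℝ => dilate K q.1.1 (q.1.2 - q.2) := by
    unfold dilate
    have := K.continuous.measurable
    fun_prop
  exact h1.stronglyMeasurable.smul (hf.comp_measurable measurable_snd)

theorem smear_add (hK : KernelBound K B) {f g : ℝ → H} (hf : MemLp f 2 volume)
    (hg : MemLp g 2 volume) {t : ℝ} (ht : 0 < t) (x : ℝ) :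
    smear K t (f + g) x = smear K t f x + smear K t g x := by
  simp only [smear, Pi.add_apply, smul_add]
  exact integral_add (hK.integrable_dilate_smul hf ht x) (hK.integrable_dilate_smul hg ht x)

theorem abs_sub_cellIndex_le (n : ℤ) (y : ℝ) :
    |y - (cellIndex n y : ℝ) * 2 ^ (-n)| ≤ 2 ^ (-n) := by
  have h := mem_cell_self n y
  rw [cell_eq_Ico, mem_Ico] at h
  rw [abs_of_nonneg (by linarith)]
  linarith [h.2]

/-- A kernel of width `t` nearly annihilates functions with mean zero on much shorter cells. -/
theorem KernelBound.lintegral_smear_sq_le (hK : KernelBound K B) [CompleteSpace H] {g : ℝ → H}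
    (hgm : StronglyMeasurable g) (hg : MemLp g 2 volume) {n : ℤ}
    (hmean : ∀ m, ∫ y in cell n m, g y = 0) {t : ℝ} (ht : 0 < t) (hn : 2 ^ (-n) ≤ t) :
    ∫⁻ x, ‖smear K t g x‖ₑ ^ 2 ≤
      ENNReal.ofReal (B * (2 ^ (-n) / t) * Real.pi) ^ 2 * ∫⁻ x, ‖g x‖ₑ ^ 2 := by
  have hB := hK.pos
  -- The left endpoint of the cell of `y`. The kernel frozen at `η y` integrates to zero against `g`
  -- cell by cell; the remainder gains the ratio of cell length to kernel width.
  set η : ℝ → ℝ := fun y => (cellIndex n y : ℝ) * 2 ^ (-n) with hη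
  have hηm : Measurable η :=
    (measurable_comp_cellIndex n fun m : ℤ => (m : ℝ) * 2 ^ (-n))
  have hbound : ∀ x y, ‖dilate K t (x - y) - dilate K t (x - η y)‖ ≤
      B * (2 ^ (-n) / t) * cauchyMajorant t (x - y) := by
    intro x y
    have h1 : |(x - y) - (x - η y)| ≤ 2 ^ (-n) := by
      rw [show (x - y) - (x - η y) = -(y - η y) by ring, abs_neg]
      exact abs_sub_cellIndex_le n y
    refine (hK.norm_dilate_sub_le ht _ _ (h1.trans hn)).trans ?_
    have := cauchyMajorant_nonneg ht (x - y)
    gcongr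
  have hint : ∀ x, Integrable fun y => (dilate K t (x - y) - dilate K t (x - η y)) • g y := by
    intro x
    refine ((integrable_cauchyMajorant_mul hg ht x).const_mul (B * (2 ^ (-n) / t))).mono' ?_
      (.of_forall fun y => ?_)
    · have hc := (continuous_dilate K t).measurable
      exact (Measurable.aestronglyMeasurable (by fun_prop)).smul hg.1
    · rw [norm_smul, ← mul_assoc]
      gcongr
      exact hbound x y
  have hzero : ∀ x, ∫ y, dilate K t (x - η y) • g y = 0 := by
    intro x
    have hi : Integrable fun y => dilate K t (x - η y) • g y := by
      refine ((hK.integrable_dilate_smul hg ht x).sub (hint x)).congr (.of_forall fun y => ?_)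
      simp [← sub_smul]
    rw [← setIntegral_univ, ← iUnion_cell n, integral_iUnion (measurableSet_cell n)
      (pairwise_disjoint_cell n) hi.integrableOn]
    refine (tsum_congr fun m => ?_).trans tsum_zero
    rw [setIntegral_congr_fun (g := fun y => dilate K t (x - (m : ℝ) * 2 ^ (-n)) • g y)
      (measurableSet_cell n m) fun y hy => by
        have : cellIndex n y = m := hy
        simp only [hη, this], integral_smul, hmean, smul_zero]
  have hpt : ∀ x, ‖smear K t g x‖ₑ ≤ ENNReal.ofReal (B * (2 ^ (-n) / t)) *
      ∫⁻ y, ENNReal.ofReal (cauchyMajorant t (x - y)) * ‖g y‖ₑ := by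
    intro x
    have h1 : smear K t g x = ∫ y, (dilate K t (x - y) - dilate K t (x - η y)) • g y := by
      have h2 : ∀ y, dilate K t (x - y) • g y =
          (dilate K t (x - y) - dilate K t (x - η y)) • g y + dilate K t (x - η y) • g y :=
        fun y => by rw [sub_smul, sub_add_cancel]
      have hi : Integrable fun y => dilate K t (x - η y) • g y := by
        refine ((hK.integrable_dilate_smul hg ht x).sub (hint x)).congr (.of_forall fun y => ?_)
        simp [← sub_smul]
      rw [smear, integral_congr_ae (.of_forall h2), integral_add (hint x) hi, hzero, add_zero]
    rw [h1, ← lintegral_const_mul' _ _ ENNReal.ofReal_ne_top]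
    refine (enorm_integral_le_lintegral_enorm _).trans (lintegral_mono fun y => ?_)
    rw [enorm_smul, ← mul_assoc, ← ENNReal.ofReal_mul (by positivity), ← ofReal_norm]
    gcongr
    exact hbound x y
  calc ∫⁻ x, ‖smear K t g x‖ₑ ^ 2 ≤ ∫⁻ x, ENNReal.ofReal (B * (2 ^ (-n) / t)) ^ 2 *
        (∫⁻ y, ENNReal.ofReal (cauchyMajorant t (x - y)) * ‖g y‖ₑ) ^ 2 :=
        lintegral_mono fun x => (pow_le_pow_left' (hpt x) 2).trans (mul_pow _ _ _).le
    _ = ENNReal.ofReal (B * (2 ^ (-n) / t)) ^ 2 *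
        ∫⁻ x, (∫⁻ y, ENNReal.ofReal (cauchyMajorant t (x - y)) * ‖g y‖ₑ) ^ 2 :=
        lintegral_const_mul' _ _ (by finiteness)
    _ ≤ ENNReal.ofReal (B * (2 ^ (-n) / t)) ^ 2 *
        ((∫⁻ x, ENNReal.ofReal (cauchyMajorant t x)) ^ 2 * ∫⁻ x, ‖g x‖ₑ ^ 2) := by
        gcongr
        exact lintegral_convolution_sq_le
          (continuous_cauchyMajorant t).measurable.ennreal_ofReal hgm.enorm
    _ = _ := by
        rw [lintegral_cauchyMajorant ht, ← mul_assoc, ← mul_pow, ← ENNReal.ofReal_mul (by positivity)]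

/-- The points that leave the cell under translation lie within |y| of one endpoint; the sign of `y`
decides which, and makes the other interval null. -/
theorem volume_cell_diff_le (j n : ℤ) (y : ℝ) :
    volume {x ∈ cell j n | x - y ∉ cell j n} ≤ ‖y‖ₑ := by
  have h : {x ∈ cell j n | x - y ∉ cell j n} ⊆ Icc ((n : ℝ) * 2 ^ (-j)) (n * 2 ^ (-j) + y) ∪
      Icc ((n : ℝ) * 2 ^ (-j) + 2 ^ (-j) + y) (n * 2 ^ (-j) + 2 ^ (-j)) := by
    rintro x ⟨hx, hxy⟩
    rw [cell_eq_Ico, mem_Ico] at hx hxy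
    rw [not_and_or, not_le, not_lt] at hxy
    rcases hxy with h | h
    · exact Or.inl ⟨hx.1, by linarith⟩
    · exact Or.inr ⟨by linarith, hx.2.le⟩
  refine (measure_mono h).trans ((measure_union_le _ _).trans ?_)
  rw [Real.volume_Icc, Real.volume_Icc, ← ofReal_norm, Real.norm_eq_abs]
  rcases le_total 0 y with hy | hy
  · rw [ENNReal.ofReal_of_nonpos (p := _ - (_ + y)) (by linarith), abs_of_nonneg hy, add_zero]
    exact ENNReal.ofReal_le_ofReal (by linarith)
  · rw [ENNReal.ofReal_of_nonpos (p := _ + y - _) (by linarith), abs_of_nonpos hy, zero_add]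
    exact ENNReal.ofReal_le_ofReal (by linarith)

-- The points of a cell moved out of it by `y` have measure at most |y|, hence occupy at most the
-- fraction 2^j |y| of the cell.
open Classical in
theorem lintegral_boundary_le (G : ℤ → ℝ≥0∞) (j : ℤ) (y : ℝ) :
    ∫⁻ x, (if cellIndex j (x - y) = cellIndex j x then 0 else G (cellIndex j x)) ≤
      ENNReal.ofReal (2 ^ j) * ‖y‖ₑ * ∫⁻ x, G (cellIndex j x) := by
  have hm : Measurable fun x : ℝ => x - y := by fun_prop
  rw [lintegral_cellIndex, lintegral_eq_tsum_cell j, mul_right_comm, mul_comm (∑' n, G n),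
    ← mul_assoc, ← ENNReal.ofReal_mul (by positivity), ← zpow_add₀ (by norm_num), add_neg_cancel,
    zpow_zero, ENNReal.ofReal_one, one_mul, ← ENNReal.tsum_mul_right]
  refine ENNReal.tsum_le_tsum fun n => ?_
  have hS : MeasurableSet {x ∈ cell j n | x - y ∉ cell j n} :=
    (measurableSet_cell j n).inter (hm (measurableSet_cell j n)).compl
  calc _ = ∫⁻ x in cell j n, {x ∈ cell j n | x - y ∉ cell j n}.indicator (fun _ => G n) x := by
        refine setLIntegral_congr_fun (measurableSet_cell j n) fun x hx => ?_
        have hx' : cellIndex j x = n := hx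
        have hxy : x - y ∈ cell j n ↔ cellIndex j (x - y) = n := Iff.rfl
        simp only [indicator, mem_ofPred_eq, hx, true_and, hx', hxy, ite_not]
    _ ≤ ∫⁻ x, {x ∈ cell j n | x - y ∉ cell j n}.indicator (fun _ => G n) x :=
        setLIntegral_le_lintegral _ _
    _ = G n * volume {x ∈ cell j n | x - y ∉ cell j n} := lintegral_indicator_const hS _
    _ ≤ G n * ‖y‖ₑ := by
        gcongr
        exact volume_cell_diff_le j n y

theorem add_enorm_sq_le (a b : H) : ‖a - b‖ₑ ^ 2 ≤ 2 * ‖a‖ₑ ^ 2 + 2 * ‖b‖ₑ ^ 2 := by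
  rw [← mul_add, enorm_sq_eq_ofReal, enorm_sq_eq_ofReal, enorm_sq_eq_ofReal,
    ← ENNReal.ofReal_add (by positivity) (by positivity), show (2 : ℝ≥0∞) = ENNReal.ofReal 2 by simp,
    ← ENNReal.ofReal_mul (by norm_num)]
  refine ENNReal.ofReal_le_ofReal ?_
  have := parallelogram_law_with_norm ℂ a b
  nlinarith [sq_nonneg ‖a + b‖]

/-- The `L²` modulus of continuity of a function that is constant on dyadic cells. -/
theorem lintegral_translate_sub_sq_le (G : ℤ → H) (j : ℤ) (y : ℝ) :
    ∫⁻ x, ‖G (cellIndex j (x - y)) - G (cellIndex j x)‖ₑ ^ 2 ≤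
      4 * (ENNReal.ofReal (2 ^ j) * ‖y‖ₑ * ∫⁻ x, ‖G (cellIndex j x)‖ₑ ^ 2) := by
  classical
  have hm : Measurable fun x : ℝ => x - y := by fun_prop
  have hset : MeasurableSet {x | cellIndex j (x - y) = cellIndex j x} :=
    measurableSet_eq_fun ((measurable_cellIndex j).comp hm) (measurable_cellIndex j)
  set u : ℝ → ℝ≥0∞ := fun x =>
    if cellIndex j (x - y) = cellIndex j x then 0 else ‖G (cellIndex j (x - y))‖ₑ ^ 2 with hu
  set v : ℝ → ℝ≥0∞ := fun x =>
    if cellIndex j (x - y) = cellIndex j x then 0 else ‖G (cellIndex j x)‖ₑ ^ 2 with hv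
  have hvm : Measurable v := Measurable.ite hset measurable_const
    (measurable_comp_cellIndex j fun n => ‖G n‖ₑ ^ 2)
  have h1 := lintegral_boundary_le (fun n => ‖G n‖ₑ ^ 2) j y
  have h2 := lintegral_boundary_le (fun n => ‖G n‖ₑ ^ 2) j (-y)
  -- Translating by `y` turns the value at x - y into the value at x, so the boundary estimate
  -- applies with `-y`.
  have h3 : ∫⁻ x, u x = ∫⁻ x, if cellIndex j (x - -y) = cellIndex j x then 0 else
      ‖G (cellIndex j x)‖ₑ ^ 2 := by
    rw [← lintegral_add_right_eq_self u y]
    refine lintegral_congr fun x => ?_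
    simp only [hu, add_sub_cancel_right, sub_neg_eq_add]
    simp only [eq_comm]
  rw [← h3, enorm_neg] at h2
  calc _ ≤ ∫⁻ x, (2 * u x + 2 * v x) := by
        refine lintegral_mono fun x => ?_
        by_cases h : cellIndex j (x - y) = cellIndex j x
        · simp [h]
        · simp only [hu, hv, if_neg h]
          exact add_enorm_sq_le _ _
    _ = 2 * (∫⁻ x, u x) + 2 * ∫⁻ x, v x := by
        rw [lintegral_add_right _ (hvm.const_mul _), lintegral_const_mul' _ _ (by norm_num),
          lintegral_const_mul' _ _ (by norm_num)]
    _ ≤ 2 * _ + 2 * _ := add_le_add (mul_le_mul_right h2 _) (mul_le_mul_right h1 _)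
    _ = _ := by ring

theorem lintegral_enorm_dilate_mul (K : 𝓢(ℝ, ℂ)) {t : ℝ} (ht : 0 < t) :
    ∫⁻ y, ‖dilate K t y‖ₑ * ‖y‖ₑ = ENNReal.ofReal t * ∫⁻ y, ‖K y‖ₑ * ‖y‖ₑ := by
  have hm : Measurable fun y : ℝ => ‖K y‖ₑ * ‖y‖ₑ := by
    have := K.continuous.measurable
    fun_prop
  rw [← lintegral_comp_div hm ht]
  refine lintegral_congr fun y => ?_
  rw [← ofReal_norm, ← ofReal_norm, ← ofReal_norm, ← ofReal_norm, norm_dilate K ht,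
    ← ENNReal.ofReal_mul (by positivity), ← ENNReal.ofReal_mul (by positivity), norm_div,
    Real.norm_of_nonneg ht.le]
  congr 1
  field_simp

theorem lintegral_enorm_dilate (K : 𝓢(ℝ, ℂ)) {t : ℝ} (ht : 0 < t) :
    ∫⁻ y, ‖dilate K t y‖ₑ = ∫⁻ y, ‖K y‖ₑ := by
  have hm : Measurable fun y : ℝ => ENNReal.ofReal t⁻¹ * ‖K y‖ₑ := by
    have := K.continuous.measurable
    fun_prop
  calc _ = ∫⁻ y, ENNReal.ofReal t⁻¹ * ‖K (y / t)‖ₑ := by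
        refine lintegral_congr fun y => ?_
        rw [← ofReal_norm, ← ofReal_norm, norm_dilate K ht, ENNReal.ofReal_mul (by positivity)]
    _ = _ := by
        rw [lintegral_comp_div hm ht, lintegral_const_mul' _ _ ENNReal.ofReal_ne_top, ← mul_assoc,
          ← ENNReal.ofReal_mul ht.le, mul_inv_cancel₀ ht.ne', ENNReal.ofReal_one, one_mul]

theorem integral_dilate (K : 𝓢(ℝ, ℂ)) {t : ℝ} (ht : 0 < t) : ∫ y, dilate K t y = ∫ y, K y := by
  simp only [dilate]
  rw [integral_const_mul, Measure.integral_comp_div (fun y => K y), abs_of_pos ht,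
    Complex.real_smul, ← mul_assoc, inv_mul_cancel₀ (by exact_mod_cast ht.ne'), one_mul]

/-- A kernel of width `t` acts nearly as a multiple of the identity on functions that are constant
on much longer cells. -/
theorem KernelBound.lintegral_smear_sub_sq_le (hK : KernelBound K B) [CompleteSpace H] (G : ℤ → H)
    {j : ℤ} (hG : MemLp (fun x => G (cellIndex j x)) 2 volume) {t : ℝ} (ht : 0 < t) :
    ∫⁻ x, ‖smear K t (fun x => G (cellIndex j x)) x - (∫ y, K y) • G (cellIndex j x)‖ₑ ^ 2 ≤
      (∫⁻ y, ‖K y‖ₑ) * (∫⁻ y, ‖K y‖ₑ * ‖y‖ₑ) * (4 * ENNReal.ofReal (2 ^ j * t)) *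
        ∫⁻ x, ‖G (cellIndex j x)‖ₑ ^ 2 := by
  have hcm := (continuous_dilate K t).measurable
  have hdiff : Measurable fun p : ℝ × ℝ => ‖G (cellIndex j (p.1 - p.2)) - G (cellIndex j p.1)‖ₑ := by
    have h := (measurable_of_countable fun q : ℤ × ℤ => ‖G q.1 - G q.2‖ₑ)
    have hc := measurable_cellIndex j
    exact h.comp (f := fun p : ℝ × ℝ => (cellIndex j (p.1 - p.2), cellIndex j p.1)) (by fun_prop)
  have hdint : Integrable (dilate K t) :=
    ((integrable_cauchyMajorant ht).const_mul B).mono' (continuous_dilate K t).aestronglyMeasurable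
      (.of_forall fun y => hK.norm_dilate_le ht y)
  have hpt : ∀ x, ‖smear K t (fun x => G (cellIndex j x)) x - (∫ y, K y) • G (cellIndex j x)‖ₑ ^ 2 ≤
      (∫⁻ y, ‖K y‖ₑ) * ∫⁻ y, ‖dilate K t y‖ₑ *
        ‖G (cellIndex j (x - y)) - G (cellIndex j x)‖ₑ ^ 2 := by
    intro x
    have h1 : smear K t (fun x => G (cellIndex j x)) x =
        ∫ y, dilate K t y • G (cellIndex j (x - y)) := by
      rw [smear, ← integral_sub_left_eq_self _ volume x]
      simp only [sub_sub_cancel]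
    have h2 : Integrable fun y => dilate K t y • G (cellIndex j (x - y)) := by
      have := (hK.integrable_dilate_smul hG ht x).comp_sub_left x
      simpa only [sub_sub_cancel] using this
    rw [h1, ← integral_dilate K ht, ← integral_smul_const,
      ← integral_sub h2 (hdint.smul_const _)]
    simp_rw [← smul_sub]
    refine (pow_le_pow_left' (enorm_integral_le_lintegral_enorm _) 2).trans ?_
    simp_rw [enorm_smul]
    rw [← lintegral_enorm_dilate K ht]
    exact lintegral_mul_sq_le hcm.enorm.aemeasurable
      (hdiff.comp (measurable_const.prodMk measurable_id)).aemeasurable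
  calc _ ≤ ∫⁻ x, (∫⁻ y, ‖K y‖ₑ) * ∫⁻ y, ‖dilate K t y‖ₑ *
        ‖G (cellIndex j (x - y)) - G (cellIndex j x)‖ₑ ^ 2 := lintegral_mono hpt
    _ = (∫⁻ y, ‖K y‖ₑ) * ∫⁻ y, ∫⁻ x, ‖dilate K t y‖ₑ *
        ‖G (cellIndex j (x - y)) - G (cellIndex j x)‖ₑ ^ 2 := by
        have hmm : Measurable fun p : ℝ × ℝ => ‖dilate K t p.2‖ₑ *
            ‖G (cellIndex j (p.1 - p.2)) - G (cellIndex j p.1)‖ₑ ^ 2 := by fun_prop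
        rw [lintegral_const_mul _ hmm.lintegral_prod_right', lintegral_lintegral_swap hmm.aemeasurable]
    _ ≤ (∫⁻ y, ‖K y‖ₑ) * ∫⁻ y, (‖dilate K t y‖ₑ * ‖y‖ₑ) *
        (4 * ENNReal.ofReal (2 ^ j) * ∫⁻ x, ‖G (cellIndex j x)‖ₑ ^ 2) := by
        gcongr with y
        rw [lintegral_const_mul' _ _ enorm_ne_top]
        refine (mul_le_mul_right (lintegral_translate_sub_sq_le G j y) _).trans (le_of_eq ?_)
        ring
    _ = _ := by
        rw [lintegral_mul_const _ (by fun_prop), lintegral_enorm_dilate_mul K ht,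
          ENNReal.ofReal_mul (by positivity)]
        ring

end Smear

/-! ### The square function of a kernel -/

section SquareFunction

variable {H : Type*} [NormedAddCommGroup H] [InnerProductSpace ℂ H]

/-- The conditional expectation on the cells of level `k`. -/
def cellExp (k : ℤ) (f : ℝ → H) (x : ℝ) : H := cellAverage f k (cellIndex k x)

/-- The difference between a kernel of width `t` and a multiple of the conditional expectation. -/
def discrepancy (K : 𝓢(ℝ, ℂ)) (t : ℝ) (k : ℤ) (f : ℝ → H) (x : ℝ) : H :=
  smear K t f x - (∫ y, K y) • cellExp k f x

theorem stronglyMeasurable_cellExp (k : ℤ) (f : ℝ → H) : StronglyMeasurable (cellExp k f) :=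
  (StronglyMeasurable.of_discrete (f := cellAverage f k)).comp_measurable (measurable_cellIndex k)

theorem memLp_cellExp {f : ℝ → H} (hf : MemLp f 2 volume) (k : ℤ) :
    MemLp (cellExp k f) 2 volume := by
  refine ⟨(stronglyMeasurable_cellExp k f).aestronglyMeasurable, ?_⟩
  have h := hf.2
  rw [eLpNorm_lt_top_iff_lintegral_rpow_enorm_lt_top (by norm_num) (by norm_num)] at h ⊢
  simp only [ENNReal.toReal_ofNat, ENNReal.rpow_ofNat] at h ⊢
  exact (lintegral_cellAverage_sq_le hf k).trans_lt h

theorem cellAverage_add {f g : ℝ → H} (hf : MemLp f 2 volume) (hg : MemLp g 2 volume) (k n : ℤ) :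
    cellAverage (f + g) k n = cellAverage f k n + cellAverage g k n := by
  simp only [cellAverage, Pi.add_apply]
  rw [integral_add (integrableOn_cell_of_memLp hf k n) (integrableOn_cell_of_memLp hg k n),
    smul_add]

theorem volume_real_cell (k n : ℤ) : volume.real (cell k n) = 2 ^ (-k) := by
  rw [measureReal_def, volume_cell, ENNReal.toReal_ofReal (by positivity)]

theorem setIntegral_cellExp [CompleteSpace H] (f : ℝ → H) (k n : ℤ) :
    ∫ y in cell k n, cellExp k f y = ∫ y in cell k n, f y := by
  have h : ∫ y in cell k n, cellExp k f y = ∫ y in cell k n, cellAverage f k n :=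
    setIntegral_congr_fun (measurableSet_cell k n) fun y hy => congrArg (cellAverage f k) hy
  rw [h, setIntegral_const, volume_real_cell, cellAverage,
    smul_smul, ← zpow_add₀ (by norm_num)]
  simp

theorem cellAverage_comp_cellIndex [CompleteSpace H] (G : ℤ → H) (k : ℤ) (i : ℕ) (x : ℝ) :
    cellAverage (fun y => G (cellIndex k y)) (k + i) (cellIndex (k + i) x) =
      G (cellIndex k x) := by
  have h : ∀ y ∈ cell (k + i) (cellIndex (k + i) x), G (cellIndex k y) = G (cellIndex k x) := by
    intro y hy
    have hy' : cellIndex (k + i) y = cellIndex (k + i) x := hy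
    have h1 := cellIndex_div_pow (k + i) y i
    have h2 := cellIndex_div_pow (k + i) x i
    rw [add_sub_cancel_right] at h1 h2
    rw [← h1, ← h2, hy']
  rw [cellAverage, setIntegral_congr_fun (measurableSet_cell _ _) h, setIntegral_const,
    volume_real_cell, smul_smul, ← zpow_add₀ (by norm_num)]
  simp

theorem setIntegral_cell_eq_zero_of_finer {g : ℝ → H} (hg : MemLp g 2 volume) (k : ℤ) (i : ℕ)
    (h : ∀ n, ∫ y in cell (k + i) n, g y = 0) (n : ℤ) : ∫ y in cell k n, g y = 0 := by
  induction i generalizing n with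
  | zero => simpa using h n
  | succ i ih =>
    refine ih (fun m => ?_) n
    rw [cell_eq_union, setIntegral_union (disjoint_children _ _) (measurableSet_cell _ _)
      (integrableOn_cell_of_memLp hg _ _) (integrableOn_cell_of_memLp hg _ _)]
    rw [Nat.cast_succ, ← add_assoc] at h
    rw [h, h, add_zero]

variable {K : 𝓢(ℝ, ℂ)} {B : ℝ}

theorem discrepancy_add (hK : KernelBound K B) {f g : ℝ → H} (hf : MemLp f 2 volume)
    (hg : MemLp g 2 volume) {t : ℝ} (ht : 0 < t) (k : ℤ) (x : ℝ) :
    discrepancy K t k (f + g) x = discrepancy K t k f x + discrepancy K t k g x := by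
  rw [discrepancy, smear_add hK hf hg ht, cellExp, cellAverage_add hf hg, smul_add, discrepancy,
    discrepancy, cellExp, cellExp]
  abel

theorem discrepancy_sum (hK : KernelBound K B) {p : ℕ → ℝ → H} (hp : ∀ q, MemLp (p q) 2 volume)
    {t : ℝ} (ht : 0 < t) (k : ℤ) (x : ℝ) (n : ℕ) :
    discrepancy K t k (∑ q ∈ Finset.range n, p q) x =
      ∑ q ∈ Finset.range n, discrepancy K t k (p q) x := by
  have hs : ∀ n, MemLp (∑ q ∈ Finset.range n, p q) 2 volume := fun n => by
    induction n with
    | zero => exact MemLp.zero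
    | succ n ih =>
      rw [Finset.sum_range_succ]
      exact ih.add (hp n)
  induction n with
  | zero => simp [discrepancy, smear, cellExp, cellAverage]
  | succ n ih =>
    rw [Finset.sum_range_succ, Finset.sum_range_succ,
      discrepancy_add hK (hs n) (hp n) ht, ih]

theorem measurable_enorm_discrepancy (K : 𝓢(ℝ, ℂ)) (t : ℝ) (k : ℤ) {f : ℝ → H}
    (hf : StronglyMeasurable f) : Measurable fun x => ‖discrepancy K t k f x‖ₑ :=
  (((stronglyMeasurable_smear K hf).comp_measurable (measurable_const.prodMk measurable_id)).sub
    ((stronglyMeasurable_cellExp k f).const_smul _)).enorm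

/-- The decomposition of `f` into martingale differences of levels `k, …, k + D`. -/
def martingalePiece (f : ℝ → H) (k : ℤ) (D : ℕ) : ℕ → ℝ → H
  | 0 => cellExp k f
  | q + 1 => if q < D then cellExp (k + q + 1) f - cellExp (k + q) f else f - cellExp (k + q) f

theorem sum_martingalePiece (f : ℝ → H) (k : ℤ) (D : ℕ) :
    ∑ q ∈ Finset.range (D + 2), martingalePiece f k D q = f := by
  have h : ∀ i ≤ D, ∑ q ∈ Finset.range (i + 1), martingalePiece f k D q = cellExp (k + i) f := by
    intro i hi
    induction i with
    | zero => simp [martingalePiece]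
    | succ i ih =>
      rw [Finset.sum_range_succ, ih (by omega), martingalePiece, if_pos (by omega), Nat.cast_succ,
        ← add_assoc]
      abel
  rw [Finset.sum_range_succ, h D le_rfl, martingalePiece, if_neg (lt_irrefl D)]
  abel

theorem memLp_martingalePiece {f : ℝ → H} (hf : MemLp f 2 volume) (k : ℤ) (D q : ℕ) :
    MemLp (martingalePiece f k D q) 2 volume := by
  cases q with
  | zero => exact memLp_cellExp hf k
  | succ q =>
    rw [martingalePiece]
    split_ifs
    · exact (memLp_cellExp hf _).sub (memLp_cellExp hf _)
    · exact hf.sub (memLp_cellExp hf _)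

theorem stronglyMeasurable_martingalePiece {f : ℝ → H} (hf : StronglyMeasurable f) (k : ℤ)
    (D q : ℕ) : StronglyMeasurable (martingalePiece f k D q) := by
  cases q with
  | zero => exact stronglyMeasurable_cellExp k f
  | succ q =>
    rw [martingalePiece]
    split_ifs
    · exact (stronglyMeasurable_cellExp _ f).sub (stronglyMeasurable_cellExp _ f)
    · exact hf.sub (stronglyMeasurable_cellExp _ f)

theorem martingalePiece_eq_comp (f : ℝ → H) (k : ℤ) {D q : ℕ} (hq : q ≤ D) :
    ∃ G : ℤ → H, martingalePiece f k D q = fun x => G (cellIndex (k + q) x) := by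
  cases q with
  | zero => exact ⟨cellAverage f k, by simp [martingalePiece, cellExp, funext_iff]⟩
  | succ q =>
    refine ⟨fun n => cellAverage f (k + q + 1) n - cellAverage f (k + q) (n / 2), ?_⟩
    ext x
    rw [martingalePiece, if_pos (by omega), Nat.cast_succ, ← add_assoc]
    simp only [cellIndex_succ_div]
    rfl

/-- Cancellation one level coarser than the piece itself; it also holds for the tail f - E_{k+D} f,
so the tail needs no separate treatment. -/
theorem setIntegral_martingalePiece [CompleteSpace H] {f : ℝ → H} (hf : MemLp f 2 volume) (k : ℤ)
    (D q : ℕ) (n : ℤ) : ∫ y in cell (k + q) n, martingalePiece f k D (q + 1) y = 0 := by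
  have hint : ∀ i j n, IntegrableOn (cellExp j f) (cell i n) := fun i j n =>
    integrableOn_cell_of_memLp (memLp_cellExp hf j) i n
  rw [martingalePiece]
  split_ifs
  · simp only [Pi.sub_apply]
    rw [integral_sub (hint _ _ _) (hint _ _ _), setIntegral_cellExp, cell_eq_union,
      setIntegral_union (disjoint_children _ _) (measurableSet_cell _ _) (hint _ _ _) (hint _ _ _),
      setIntegral_union (disjoint_children _ _) (measurableSet_cell _ _)
        (integrableOn_cell_of_memLp hf _ _) (integrableOn_cell_of_memLp hf _ _),
      setIntegral_cellExp, setIntegral_cellExp, sub_self]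
  · simp only [Pi.sub_apply]
    rw [integral_sub (integrableOn_cell_of_memLp hf _ _) (hint _ _ _), setIntegral_cellExp,
      sub_self]

/-- The constant is 5 = 1 + 4: all pieces but the tail are orthogonal and add up to ‖E_{k+D} f‖²,
and the tail is bounded by (a - b)² ≤ 2a² + 2b². -/
theorem sum_lintegral_martingalePiece_sq_le {f : ℝ → H} (hfm : StronglyMeasurable f)
    (hf : MemLp f 2 volume) (k : ℤ) (D : ℕ) :
    ∑ q ∈ Finset.range (D + 2), ∫⁻ x, ‖martingalePiece f k D q x‖ₑ ^ 2 ≤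
      5 * ∫⁻ x, ‖f x‖ₑ ^ 2 := by
  have hU := isTreeMartingale_cellAverage hf
  have h1 : ∑ q ∈ Finset.range (D + 1), ∫⁻ x, ‖martingalePiece f k D q x‖ₑ ^ 2 ≤
      ∫⁻ x, ‖f x‖ₑ ^ 2 := by
    refine le_trans (le_of_eq ?_) (lintegral_cellAverage_sq_le hf (k + D))
    simp_rw [enorm_sq_eq_ofReal]
    rw [hU.lintegral_sq, Finset.sum_range_succ', add_comm]
    congr 1
    refine Finset.sum_congr rfl fun q hq => lintegral_congr fun x => ?_
    rw [martingalePiece, if_pos (Finset.mem_range.1 hq), ← cellIndex_succ_div,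
      ← hU.norm_sub_sq, cellIndex_succ_div]
    rfl
  rw [Finset.sum_range_succ, martingalePiece, if_neg (lt_irrefl D)]
  have h2 : ∫⁻ x, ‖(f - cellExp (k + D) f) x‖ₑ ^ 2 ≤ 4 * ∫⁻ x, ‖f x‖ₑ ^ 2 := by
    calc _ ≤ ∫⁻ x, (2 * ‖f x‖ₑ ^ 2 + 2 * ‖cellExp (k + D) f x‖ₑ ^ 2) :=
          lintegral_mono fun x => add_enorm_sq_le _ _
      _ = 2 * (∫⁻ x, ‖f x‖ₑ ^ 2) + 2 * ∫⁻ x, ‖cellExp (k + D) f x‖ₑ ^ 2 := by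
          have := hfm.enorm
          rw [lintegral_add_left (by fun_prop), lintegral_const_mul' _ _ (by norm_num),
            lintegral_const_mul' _ _ (by norm_num)]
      _ ≤ 2 * (∫⁻ x, ‖f x‖ₑ ^ 2) + 2 * ∫⁻ x, ‖f x‖ₑ ^ 2 := by
          exact add_le_add le_rfl (mul_le_mul_right (lintegral_cellAverage_sq_le hf _) _)
      _ = _ := by ring
  refine (add_le_add h1 h2).trans (le_of_eq ?_)
  ring

theorem ofReal_two_zpow_neg (i : ℕ) : ENNReal.ofReal (2 ^ (-(i : ℤ))) = 2⁻¹ ^ i := by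
  rw [← two_zpow_eq_ofReal, ENNReal.zpow_neg, zpow_natCast, ENNReal.inv_pow]

/-- The constant in the square function estimate. -/
def kernelConstant (K : 𝓢(ℝ, ℂ)) (B : ℝ) : ℝ≥0∞ :=
  8 * ((∫⁻ y, ‖K y‖ₑ) * ∫⁻ y, ‖K y‖ₑ * ‖y‖ₑ) + 2 * ENNReal.ofReal (B * Real.pi) ^ 2

theorem kernelConstant_ne_top (K : 𝓢(ℝ, ℂ)) (B : ℝ) : kernelConstant K B ≠ ∞ := by
  have h1 : ∫⁻ y, ‖K y‖ₑ ≠ ∞ := K.integrable.2.ne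
  have h2 : ∫⁻ y, ‖K y‖ₑ * ‖y‖ₑ ≠ ∞ := by
    have := (K.integrable_pow_mul volume 1).2.ne
    simpa only [pow_one, enorm_mul, enorm_norm, mul_comm] using this
  unfold kernelConstant
  finiteness

/-- The squared norm gains 2^(-|a - q|). For q ≤ a the piece is constant on cells of level k + q, so
the conditional expectation fixes it and the narrow kernel nearly multiplies it by ∫ K. For q > a
the conditional expectation annihilates it, and the wide kernel nearly does so by cancellation. -/
theorem KernelBound.lintegral_discrepancy_piece_le (hK : KernelBound K B) [CompleteSpace H]
    {f : ℝ → H} (hfm : StronglyMeasurable f) (hf : MemLp f 2 volume) (k : ℤ) {D a q : ℕ}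
    (ha : a ≤ D) {s : ℝ} (hs : s ∈ Icc (1 : ℝ) 2) :
    ∫⁻ x, ‖discrepancy K (s * 2 ^ (-(k + a))) (k + a) (martingalePiece f k D q) x‖ₑ ^ 2 ≤
      kernelConstant K B * 2⁻¹ ^ ((a - q) + (q - a)) *
        ∫⁻ x, ‖martingalePiece f k D q x‖ₑ ^ 2 := by
  have ht : 0 < s * (2 : ℝ) ^ (-(k + a)) := by have := hs.1; positivity
  have hB := hK.pos
  rcases le_or_gt q a with hqa | hqa
  · obtain ⟨G, hG⟩ := martingalePiece_eq_comp f k (hqa.trans ha)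
    have hGm := memLp_martingalePiece hf k D q
    rw [hG] at hGm ⊢
    obtain ⟨i, rfl⟩ := Nat.exists_eq_add_of_le hqa
    have h1 : ∀ x, cellExp (k + (q + i : ℕ)) (fun x => G (cellIndex (k + q) x)) x =
        G (cellIndex (k + q) x) := fun x => by
      rw [cellExp, Nat.cast_add, ← add_assoc, cellAverage_comp_cellIndex]
    simp only [discrepancy, h1]
    refine (hK.lintegral_smear_sub_sq_le G hGm ht).trans ?_
    gcongr ?_ * _
    have h2 : ENNReal.ofReal (2 ^ (k + (q : ℤ)) * (s * 2 ^ (-(k + (q + i : ℕ))))) ≤ 2 * 2⁻¹ ^ i := by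
      rw [← ofReal_two_zpow_neg, show (2 : ℝ≥0∞) = ENNReal.ofReal 2 by simp,
        ← ENNReal.ofReal_mul (by norm_num)]
      refine ENNReal.ofReal_le_ofReal ?_
      rw [mul_left_comm, ← zpow_add₀ (by norm_num), show k + (q : ℤ) + -(k + (q + i : ℕ)) = -(i : ℤ) by
        push_cast; ring]
      have := hs.2
      gcongr
    rw [show q + i - q + (q - (q + i)) = i by omega]
    calc _ ≤ (∫⁻ y, ‖K y‖ₑ) * (∫⁻ y, ‖K y‖ₑ * ‖y‖ₑ) * (4 * (2 * 2⁻¹ ^ i)) := by gcongr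
      _ = 8 * ((∫⁻ y, ‖K y‖ₑ) * ∫⁻ y, ‖K y‖ₑ * ‖y‖ₑ) * 2⁻¹ ^ i := by ring
      _ ≤ _ := by
        gcongr
        exact le_self_add
  · obtain ⟨i, rfl⟩ : ∃ i, q = a + i + 1 := ⟨q - a - 1, by omega⟩
    have hmean := setIntegral_martingalePiece hf k D (a + i)
    have hm := memLp_martingalePiece hf k D (a + i + 1)
    have h1 : ∀ x, cellExp (k + a) (martingalePiece f k D (a + i + 1)) x = 0 := fun x => by
      rw [cellExp, cellAverage, setIntegral_cell_eq_zero_of_finer hm (k + a) i, smul_zero]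
      intro n
      rw [← hmean n]
      push_cast
      rw [add_assoc]
    simp only [discrepancy, h1, smul_zero, sub_zero]
    have h3 : (2 : ℝ) ^ (-(k + (a + i : ℕ))) = 2 ^ (-(k + a)) * 2 ^ (-(i : ℤ)) := by
      rw [← zpow_add₀ (by norm_num)]; congr 1; push_cast; ring
    have h4 : (2 : ℝ) ^ (-(i : ℤ)) ≤ 1 := by
      rw [zpow_neg, zpow_natCast]
      exact inv_le_one_of_one_le₀ (one_le_pow₀ (by norm_num))
    have hpos : (0 : ℝ) < 2 ^ (-(k + a : ℤ)) := by positivity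
    refine (hK.lintegral_smear_sq_le (stronglyMeasurable_martingalePiece hfm k D _) hm hmean ht
      ?_).trans ?_
    · rw [h3, mul_comm]
      exact mul_le_mul_of_nonneg_right (h4.trans hs.1) hpos.le
    · gcongr ?_ * _
      have h5 : ENNReal.ofReal (B * (2 ^ (-(k + (a + i : ℕ))) / (s * 2 ^ (-(k + (a : ℤ))))) * Real.pi) ≤
          ENNReal.ofReal (B * Real.pi) * 2⁻¹ ^ i := by
        rw [← ofReal_two_zpow_neg, ← ENNReal.ofReal_mul (by positivity)]
        refine ENNReal.ofReal_le_ofReal ?_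
        rw [h3, mul_comm s, mul_div_mul_left _ _ hpos.ne', mul_right_comm]
        gcongr
        exact div_le_self (by positivity) hs.1
      have h6 : (2⁻¹ : ℝ≥0∞) ^ i ≤ 1 := pow_le_one₀ (by simp) (by simp)
      rw [show a - (a + i + 1) + (a + i + 1 - a) = i + 1 by omega]
      calc _ ≤ (ENNReal.ofReal (B * Real.pi) * 2⁻¹ ^ i) ^ 2 := pow_le_pow_left' h5 2
        _ = ENNReal.ofReal (B * Real.pi) ^ 2 * 2⁻¹ ^ i * 2⁻¹ ^ i := by ring
        _ ≤ ENNReal.ofReal (B * Real.pi) ^ 2 * 2⁻¹ ^ i * 1 := by gcongr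
        -- The piece has mean zero on level a + i but index distance i + 1; the factor 2 in
        -- `kernelConstant` pays for this shift. The second factor 2^(-i) has been discarded.
        _ = 2 * ENNReal.ofReal (B * Real.pi) ^ 2 * 2⁻¹ ^ (i + 1) := by
          have h7 : (2⁻¹ : ℝ≥0∞) ^ i = 2 * 2⁻¹ ^ (i + 1) := by
            rw [pow_succ', ← mul_assoc, ENNReal.mul_inv_cancel (by norm_num) (by norm_num), one_mul]
          rw [h7]
          ring
        _ ≤ _ := by
          gcongr
          exact le_add_self

theorem sum_geometric_dist_le (r : ℝ≥0∞) (q n : ℕ) :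
    ∑ a ∈ Finset.range n, r ^ ((a - q) + (q - a)) ≤ 2 * (1 - r)⁻¹ := by
  classical
  rw [← Finset.sum_filter_add_sum_filter_not _ (fun a => a ≤ q), two_mul, ← ENNReal.tsum_geometric]
  refine add_le_add ?_ ?_
  · rw [Finset.sum_congr rfl (g := fun a => r ^ (q - a)) fun a ha => by
      rw [Nat.sub_eq_zero_of_le (Finset.mem_filter.1 ha).2, zero_add],
      ← Finset.sum_image (g := fun a => q - a) (f := fun i => r ^ i)]
    · exact ENNReal.sum_le_tsum _
    · intro a ha b hb hab
      have h1 := (Finset.mem_filter.1 ha).2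
      have h2 := (Finset.mem_filter.1 hb).2
      simp only at hab
      omega
  · rw [Finset.sum_congr rfl (g := fun a => r ^ (a - q)) fun a ha => by
      rw [Nat.sub_eq_zero_of_le (not_le.1 (Finset.mem_filter.1 ha).2).le, add_zero],
      ← Finset.sum_image (g := fun a => a - q) (f := fun i => r ^ i)]
    · exact ENNReal.sum_le_tsum _
    · intro a ha b hb hab
      have h1 := (Finset.mem_filter.1 ha).2
      have h2 := (Finset.mem_filter.1 hb).2
      simp only at hab
      omega

theorem sum_mul_sq_le {ι : Type*} (s : Finset ι) (w h : ι → ℝ≥0∞) :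
    (∑ i ∈ s, w i * h i) ^ 2 ≤ (∑ i ∈ s, w i) * ∑ i ∈ s, w i * h i ^ 2 := by
  have := tsum_mul_sq_le (fun i : s => w i) (fun i : s => h i)
  simpa only [Finset.tsum_subtype s (fun i => w i * h i), Finset.tsum_subtype s w,
    Finset.tsum_subtype s (fun i => w i * h i ^ 2)] using this

/-- Almost orthogonality: the square function of the discrepancies is bounded on `L²`. -/
theorem KernelBound.tsum_lintegral_discrepancy_le (hK : KernelBound K B) [CompleteSpace H]
    {f : ℝ → H} (hfm : StronglyMeasurable f) (hf : MemLp f 2 volume) {s : ℝ}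
    (hs : s ∈ Icc (1 : ℝ) 2) :
    ∑' k : ℤ, ∫⁻ x, ‖discrepancy K (s * 2 ^ (-k)) k f x‖ₑ ^ 2 ≤
      240 * kernelConstant K B * ∫⁻ x, ‖f x‖ₑ ^ 2 := by
  refine tsum_int_le_of_sum_range_le fun k D => ?_
  set p := martingalePiece f k D with hp
  -- Any ratio strictly between 1/2 and 1 would do: Cauchy–Schwarz with weights r^|a-q| needs r < 1,
  -- and what remains of the gain is (r⁻¹/2)^|a-q|, here with ratio 2/3. The two geometric sums give
  -- 8 and 6, and 240 = 8 · 6 · 5.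
  set r : ℝ≥0∞ := ENNReal.ofReal (3 / 4) with hr
  set C := kernelConstant K B with hC
  have hr0 : r ≠ 0 := by simp [hr]
  have hrt : r ≠ ∞ := by simp [hr]
  have hrr : r⁻¹ * 2⁻¹ = ENNReal.ofReal (2 / 3) := by
    rw [hr, ← ENNReal.ofReal_inv_of_pos (by norm_num), show (2⁻¹ : ℝ≥0∞) = ENNReal.ofReal 2⁻¹ by
      rw [ENNReal.ofReal_inv_of_pos (by norm_num)]; simp, ← ENNReal.ofReal_mul (by norm_num)]
    norm_num
  have hgeo1 : 2 * (1 - r)⁻¹ = 8 := by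
    rw [hr, ← ENNReal.ofReal_one, ← ENNReal.ofReal_sub _ (by norm_num),
      ← ENNReal.ofReal_inv_of_pos (by norm_num), show (2 : ℝ≥0∞) = ENNReal.ofReal 2 by simp,
      ← ENNReal.ofReal_mul (by norm_num)]
    norm_num
  have hgeo2 : 2 * (1 - ENNReal.ofReal (2 / 3))⁻¹ = 6 := by
    rw [← ENNReal.ofReal_one, ← ENNReal.ofReal_sub _ (by norm_num),
      ← ENNReal.ofReal_inv_of_pos (by norm_num), show (2 : ℝ≥0∞) = ENNReal.ofReal 2 by simp,
      ← ENNReal.ofReal_mul (by norm_num)]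
    norm_num
  have hlevel : ∀ a ∈ Finset.range D, ∫⁻ x, ‖discrepancy K (s * 2 ^ (-(k + a))) (k + a) f x‖ₑ ^ 2 ≤
      8 * ∑ q ∈ Finset.range (D + 2), C * ENNReal.ofReal (2 / 3) ^ ((a - q) + (q - a)) *
        ∫⁻ x, ‖p q x‖ₑ ^ 2 := by
    intro a ha
    have ht : 0 < s * (2 : ℝ) ^ (-(k + a : ℤ)) := by have := hs.1; positivity
    set e : ℕ → ℝ → ℝ≥0∞ := fun q x => ‖discrepancy K (s * 2 ^ (-(k + a))) (k + a) (p q) x‖ₑ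
    have hem : ∀ q, Measurable (e q) := fun q =>
      measurable_enorm_discrepancy K _ _ (stronglyMeasurable_martingalePiece hfm k D q)
    have hpt : ∀ x, ‖discrepancy K (s * 2 ^ (-(k + a))) (k + a) f x‖ₑ ^ 2 ≤
        8 * ∑ q ∈ Finset.range (D + 2), (r⁻¹) ^ ((a - q) + (q - a)) * e q x ^ 2 := by
      intro x
      have hw : ∀ i : ℕ, r ^ i * r⁻¹ ^ i = 1 := fun i => by
        rw [← mul_pow, ENNReal.mul_inv_cancel hr0 hrt, one_pow]
      conv_lhs => rw [← sum_martingalePiece f k D,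
        discrepancy_sum hK (memLp_martingalePiece hf k D) ht]
      calc _ ≤ (∑ q ∈ Finset.range (D + 2), r ^ ((a - q) + (q - a)) *
            (r⁻¹ ^ ((a - q) + (q - a)) * e q x)) ^ 2 := by
            refine pow_le_pow_left' ((enorm_sum_le _ _).trans (le_of_eq ?_)) 2
            refine Finset.sum_congr rfl fun q _ => ?_
            rw [← mul_assoc, hw, one_mul]
        _ ≤ _ := sum_mul_sq_le _ _ _
        _ ≤ _ := by
            gcongr ?_ * ?_
            · rw [← hgeo1]
              simpa only [add_comm] using sum_geometric_dist_le r a (D + 2)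
            · refine Finset.sum_le_sum fun q _ => le_of_eq ?_
              rw [mul_pow, ← mul_assoc, sq (r⁻¹ ^ _), ← mul_assoc, hw, one_mul]
    calc _ ≤ _ := lintegral_mono hpt
      _ = 8 * ∑ q ∈ Finset.range (D + 2), r⁻¹ ^ ((a - q) + (q - a)) * ∫⁻ x, e q x ^ 2 := by
          rw [lintegral_const_mul' _ _ (by norm_num), lintegral_finsetSum _ fun q _ => by
            have := hem q; fun_prop]
          simp_rw [lintegral_const_mul _ ((hem _).pow_const 2)]
      _ ≤ _ := by
          refine mul_le_mul_right (Finset.sum_le_sum fun q _ => ?_) _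
          refine (mul_le_mul_right (hK.lintegral_discrepancy_piece_le hfm hf k
            (Finset.mem_range.1 ha).le hs) _).trans (le_of_eq ?_)
          rw [← hrr, mul_pow]
          ring
  calc _ ≤ ∑ a ∈ Finset.range D, 8 * ∑ q ∈ Finset.range (D + 2),
        C * ENNReal.ofReal (2 / 3) ^ ((a - q) + (q - a)) * ∫⁻ x, ‖p q x‖ₑ ^ 2 :=
        Finset.sum_le_sum hlevel
    _ = 8 * ∑ q ∈ Finset.range (D + 2), C * (∑ a ∈ Finset.range D,
        ENNReal.ofReal (2 / 3) ^ ((a - q) + (q - a))) * ∫⁻ x, ‖p q x‖ₑ ^ 2 := by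
        rw [← Finset.mul_sum, Finset.sum_comm]
        refine congrArg _ (Finset.sum_congr rfl fun q _ => ?_)
        rw [Finset.mul_sum, Finset.sum_mul]
    _ ≤ 8 * ∑ q ∈ Finset.range (D + 2), C * 6 * ∫⁻ x, ‖p q x‖ₑ ^ 2 := by
        gcongr with q
        rw [← hgeo2]
        exact sum_geometric_dist_le _ q D
    _ = 48 * C * ∑ q ∈ Finset.range (D + 2), ∫⁻ x, ‖p q x‖ₑ ^ 2 := by
        rw [← Finset.mul_sum]; ring
    _ ≤ 48 * C * (5 * ∫⁻ x, ‖f x‖ₑ ^ 2) := by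
        gcongr
        exact sum_lintegral_martingalePiece_sq_le hfm hf k D
    _ = _ := by ring

end SquareFunction

/-! ### Variation of the convolutions within a dyadic block of scales -/

section Block

variable {H : Type*} [NormedAddCommGroup H] [InnerProductSpace ℂ H]

/-- The kernel `(x φ(x))'`, which generates the derivative of `φ_t` in `t`. -/
def derivKernel (φ : 𝓢(ℝ, ℂ)) : 𝓢(ℝ, ℂ) :=
  SchwartzMap.derivCLM ℂ ℂ (SchwartzMap.smulLeftCLM ℂ (fun x : ℝ => x) φ)

theorem derivKernel_apply (φ : 𝓢(ℝ, ℂ)) (x : ℝ) : derivKernel φ x = φ x + x * deriv φ x := by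
  have h : (SchwartzMap.smulLeftCLM ℂ (fun x : ℝ => x) φ : ℝ → ℂ) = fun x : ℝ => (x : ℂ) * φ x := by
    ext y
    rw [SchwartzMap.smulLeftCLM_apply_apply (by fun_prop)]
    simp
  rw [derivKernel, SchwartzMap.derivCLM_apply, h]
  have := (Complex.ofRealCLM.hasDerivAt (x := x)).mul (φ.hasDerivAt x)
  simp only [Complex.ofRealCLM_apply, Complex.ofReal_one, one_mul] at this
  exact this.deriv

/-- With mean zero the discrepancy of this kernel is the convolution itself, so the square function
estimate bounds the scale derivative of f * φ_t without any martingale term. -/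
theorem integral_derivKernel (φ : 𝓢(ℝ, ℂ)) : ∫ x, derivKernel φ x = 0 :=
  integral_eq_zero_of_hasDerivAt_of_integrable
    (f := SchwartzMap.smulLeftCLM ℂ (fun x : ℝ => x) φ) (fun x => SchwartzMap.hasDerivAt _ x)
    (derivKernel φ).integrable (SchwartzMap.integrable _)

theorem hasDerivAt_dilate (φ : 𝓢(ℝ, ℂ)) {τ : ℝ} (hτ : 0 < τ) (y : ℝ) {s : ℝ} (hs : 0 < s) :
    HasDerivAt (fun s => dilate φ (s * τ) y) (-((s : ℂ)⁻¹ * dilate (derivKernel φ) (s * τ) y)) s := by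
  have h0 : s * τ ≠ 0 := by positivity
  have h1 : HasDerivAt (fun s : ℝ => s * τ) τ s := by simpa using (hasDerivAt_id s).mul_const τ
  have h2 : HasDerivAt (fun s : ℝ => y / (s * τ)) (-(y * τ) / (s * τ) ^ 2) s := by
    refine ((hasDerivAt_const s y).div h1 h0).congr_deriv ?_
    simp
  have h3 := HasDerivAt.scomp s (φ.hasDerivAt (y / (s * τ))) h2
  have h4 : HasDerivAt (fun s : ℝ => ((s * τ : ℝ) : ℂ)⁻¹) ((-τ / (s * τ) ^ 2 : ℝ) : ℂ) s := by
    simpa using (h1.inv h0).ofReal_comp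
  have h5 := h4.mul h3
  refine h5.congr_deriv ?_
  rw [dilate, derivKernel_apply]
  have hs' : (s : ℂ) ≠ 0 := by exact_mod_cast hs.ne'
  have hτ' : (τ : ℂ) ≠ 0 := by exact_mod_cast hτ.ne'
  simp only [Complex.real_smul, Function.comp_apply]
  push_cast
  field_simp
  ring

theorem dilate_sub_dilate (φ : 𝓢(ℝ, ℂ)) {τ : ℝ} (hτ : 0 < τ) (y : ℝ) {a b : ℝ} (ha : 1 ≤ a)
    (hab : a ≤ b) : dilate φ (b * τ) y - dilate φ (a * τ) y =
      ∫ s in Ioc a b, -((s : ℂ)⁻¹ * dilate (derivKernel φ) (s * τ) y) := by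
  rw [← intervalIntegral.integral_of_le hab]
  symm
  refine intervalIntegral.integral_eq_sub_of_hasDerivAt (f := fun s => dilate φ (s * τ) y)
    (fun s hs => hasDerivAt_dilate φ hτ y ?_) ?_
  · rw [uIcc_of_le hab] at hs
    linarith [hs.1]
  · refine ContinuousOn.intervalIntegrable fun s hs => ?_
    rw [uIcc_of_le hab] at hs
    have hs0 : s ≠ 0 := by have := hs.1; intro h; linarith
    have hs0' : (s : ℂ) ≠ 0 := by exact_mod_cast hs0
    have hsτ : ((s * τ : ℝ) : ℂ) ≠ 0 := by exact_mod_cast mul_ne_zero hs0 hτ.ne'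
    have hc := (derivKernel φ).continuous
    refine ContinuousAt.continuousWithinAt ?_
    unfold dilate
    have h1 : ContinuousAt (fun s : ℝ => y / (s * τ)) s :=
      continuousAt_const.div (by fun_prop) (mul_ne_zero hs0 hτ.ne')
    have h2 : ContinuousAt (fun s : ℝ => derivKernel φ (y / (s * τ))) s :=
      hc.continuousAt.comp h1
    have h3 : ContinuousAt (fun s : ℝ => (s : ℂ)⁻¹) s :=
      ContinuousAt.inv₀ (by fun_prop) hs0'
    have h4 : ContinuousAt (fun s : ℝ => ((s * τ : ℝ) : ℂ)⁻¹) s :=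
      ContinuousAt.inv₀ (by fun_prop) hsτ
    exact (h3.mul (h4.mul h2)).neg

/-- One majorant for a whole dyadic block of scales; it provides the domination for Fubini in the
next lemma. -/
theorem cauchyMajorant_mul_le {τ : ℝ} (hτ : 0 < τ) {s : ℝ} (hs : s ∈ Icc (1 : ℝ) 2) (x : ℝ) :
    cauchyMajorant (s * τ) x ≤ 2 * cauchyMajorant (2 * τ) x := by
  have hs1 := hs.1
  have hs2 := hs.2
  have h1 : 2 * (2 * τ)⁻¹ = τ⁻¹ := by field_simp
  rw [cauchyMajorant, cauchyMajorant, ← mul_assoc, h1]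
  have h2 : (x / (2 * τ)) ^ 2 ≤ (x / (s * τ)) ^ 2 := by
    rw [div_pow, div_pow]
    gcongr
  gcongr
  nlinarith

/-- The convolution is Lipschitz in the scale, with the derivative controlled by `derivKernel`. -/
theorem enorm_smear_sub_smear_le [CompleteSpace H] (φ : 𝓢(ℝ, ℂ)) {f : ℝ → H}
    (hfm : StronglyMeasurable f) (hf : MemLp f 2 volume) {τ : ℝ} (hτ : 0 < τ) (x : ℝ) {a b : ℝ}
    (ha : 1 ≤ a) (hab : a ≤ b) (hb : b ≤ 2) :
    ‖smear φ (b * τ) f x - smear φ (a * τ) f x‖ₑ ≤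
      ∫⁻ s in Ioc a b, ‖smear (derivKernel φ) (s * τ) f x‖ₑ := by
  obtain ⟨B, hB⟩ := exists_kernelBound φ
  obtain ⟨B', hB'⟩ := exists_kernelBound (derivKernel φ)
  set F : ℝ → ℝ → H := fun s y =>
    (-((s : ℂ)⁻¹ * dilate (derivKernel φ) (s * τ) (x - y))) • f y with hF
  have hFm : StronglyMeasurable (Function.uncurry F) := by
    have h1 : Measurable fun q : ℝ × ℝ =>
        -((q.1 : ℂ)⁻¹ * dilate (derivKernel φ) (q.1 * τ) (x - q.2)) := by
      unfold dilate
      have := (derivKernel φ).continuous.measurable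
      fun_prop
    exact h1.stronglyMeasurable.smul (hfm.comp_measurable measurable_snd)
  have hFi : Integrable (Function.uncurry F) ((volume.restrict (Ioc a b)).prod volume) := by
    have hdom : Integrable (fun q : ℝ × ℝ => B' * 2 * (cauchyMajorant (2 * τ) (x - q.2) * ‖f q.2‖))
        ((volume.restrict (Ioc a b)).prod volume) :=
      ((integrable_cauchyMajorant_mul hf (t := 2 * τ) (by positivity) x).comp_snd _).const_mul _
    refine hdom.mono' hFm.aestronglyMeasurable ?_
    have hmem : ∀ᵐ q : ℝ × ℝ ∂(volume.restrict (Ioc a b)).prod volume, q.1 ∈ Ioc a b :=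
      Measure.quasiMeasurePreserving_fst.ae (ae_restrict_mem measurableSet_Ioc)
    filter_upwards [hmem] with q hq
    have hq1 : 1 ≤ q.1 := ha.trans hq.1.le
    have hq2 : q.1 ≤ 2 := hq.2.trans hb
    have hq0 : 0 < q.1 := by linarith
    have hpos := hB'.pos
    simp only [Function.uncurry, hF, norm_smul, norm_neg, norm_mul, norm_inv, Complex.norm_real,
      Real.norm_of_nonneg hq0.le]
    rw [← mul_assoc]
    refine mul_le_mul_of_nonneg_right ?_ (norm_nonneg _)
    calc q.1⁻¹ * ‖dilate (derivKernel φ) (q.1 * τ) (x - q.2)‖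
        ≤ 1 * (B' * cauchyMajorant (q.1 * τ) (x - q.2)) := by
          gcongr
          · exact inv_le_one_of_one_le₀ hq1
          · exact hB'.norm_dilate_le (by positivity) _
      _ ≤ _ := by
          rw [one_mul, mul_assoc]
          gcongr
          exact cauchyMajorant_mul_le hτ ⟨hq1, hq2⟩ _
  have hb0 : 0 < b := by linarith
  have ha0 : 0 < a := by linarith
  have h1 : smear φ (b * τ) f x - smear φ (a * τ) f x = ∫ s in Ioc a b, ∫ y, F s y := by
    rw [integral_integral_swap hFi, smear, smear, ← integral_sub
      (hB.integrable_dilate_smul hf (by positivity) x)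
      (hB.integrable_dilate_smul hf (by positivity) x)]
    refine integral_congr_ae (.of_forall fun y => ?_)
    simp only [hF]
    rw [integral_smul_const, ← dilate_sub_dilate φ hτ _ ha hab, sub_smul]
  rw [h1]
  refine (enorm_integral_le_lintegral_enorm _).trans
    (setLIntegral_mono' measurableSet_Ioc fun s hs => ?_)
  have hs1 : 1 ≤ s := ha.trans hs.1.le
  have h2 : ∫ y, F s y = (-(s : ℂ)⁻¹) • smear (derivKernel φ) (s * τ) f x := by
    rw [smear, ← integral_smul]
    refine integral_congr_ae (.of_forall fun y => ?_)
    simp only [hF, smul_smul, neg_mul]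
  rw [h2, enorm_smul]
  refine mul_le_of_le_one_left' ?_
  rw [enorm_neg, ← ofReal_norm, norm_inv, Complex.norm_real, Real.norm_of_nonneg (by linarith)]
  exact ENNReal.ofReal_le_one.2 (inv_le_one_of_one_le₀ hs1)

/-- A bound for the length of the curve `t ↦ f * φ_t(x)`, `2 ^ (-k) ≤ t ≤ 2 ^ (1 - k)`. -/
def blockLength (φ : 𝓢(ℝ, ℂ)) (f : ℝ → H) (k : ℤ) (x : ℝ) : ℝ≥0∞ :=
  ∫⁻ s in Ioc (1 : ℝ) 2, ‖smear (derivKernel φ) (s * 2 ^ (-k)) f x‖ₑ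

/-- A bound for the distance of `f * φ_t(x)` to a multiple of the dyadic martingale, for all `t`
in a dyadic block. -/
def blockError (φ : 𝓢(ℝ, ℂ)) (f : ℝ → H) (k : ℤ) (x : ℝ) : ℝ≥0∞ :=
  ‖discrepancy φ (1 * 2 ^ (-k)) k f x‖ₑ + blockLength φ f k x

theorem measurable_smear_block (K : 𝓢(ℝ, ℂ)) {f : ℝ → H} (hf : StronglyMeasurable f) (k : ℤ) :
    Measurable fun p : ℝ × ℝ => ‖smear K (p.2 * 2 ^ (-k)) f p.1‖ₑ := by
  have h : Measurable fun p : ℝ × ℝ => (p.2 * (2 : ℝ) ^ (-k), p.1) := by fun_prop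
  exact ((stronglyMeasurable_smear K hf).comp_measurable h).enorm

theorem measurable_blockLength (φ : 𝓢(ℝ, ℂ)) {f : ℝ → H} (hf : StronglyMeasurable f) (k : ℤ) :
    Measurable (blockLength φ f k) :=
  (measurable_smear_block (derivKernel φ) hf k).lintegral_prod_right'

theorem measurable_blockError (φ : 𝓢(ℝ, ℂ)) {f : ℝ → H} (hf : StronglyMeasurable f) (k : ℤ) :
    Measurable (blockError φ f k) :=
  (measurable_enorm_discrepancy φ _ k hf).add (measurable_blockLength φ hf k)

/-- Cauchy–Schwarz in s on the interval (1, 2] of length one, then the square function estimate for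
each fixed s, whose constant is uniform in s. -/
theorem tsum_lintegral_blockLength_sq_le [CompleteSpace H] {φ : 𝓢(ℝ, ℂ)} {B : ℝ}
    (hB : KernelBound (derivKernel φ) B) {f : ℝ → H} (hfm : StronglyMeasurable f)
    (hf : MemLp f 2 volume) :
    ∑' k : ℤ, ∫⁻ x, blockLength φ f k x ^ 2 ≤
      240 * kernelConstant (derivKernel φ) B * ∫⁻ x, ‖f x‖ₑ ^ 2 := by
  have hvol : volume (Ioc (1 : ℝ) 2) = 1 := by rw [Real.volume_Ioc]; norm_num
  have hm := measurable_smear_block (derivKernel φ) hfm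
  have hd : ∀ s k x, smear (derivKernel φ) (s * 2 ^ (-k)) f x =
      discrepancy (derivKernel φ) (s * 2 ^ (-k)) k f x := fun s k x => by
    rw [discrepancy, integral_derivKernel, zero_smul, sub_zero]
  calc ∑' k : ℤ, ∫⁻ x, blockLength φ f k x ^ 2
      ≤ ∑' k : ℤ, ∫⁻ x, ∫⁻ s in Ioc (1 : ℝ) 2,
          ‖smear (derivKernel φ) (s * 2 ^ (-k)) f x‖ₑ ^ 2 := by
        refine ENNReal.tsum_le_tsum fun k => lintegral_mono fun x => ?_
        have := lintegral_mul_sq_le (μ := volume.restrict (Ioc (1 : ℝ) 2)) (w := fun _ => 1)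
          (h := fun s => ‖smear (derivKernel φ) (s * 2 ^ (-k)) f x‖ₑ) aemeasurable_const
          ((hm k).comp (measurable_const.prodMk measurable_id)).aemeasurable
        rw [lintegral_const, Measure.restrict_apply_univ, hvol] at this
        simp only [one_mul] at this
        exact this
    _ = ∑' k : ℤ, ∫⁻ s in Ioc (1 : ℝ) 2, ∫⁻ x,
          ‖smear (derivKernel φ) (s * 2 ^ (-k)) f x‖ₑ ^ 2 :=
        tsum_congr fun k => lintegral_lintegral_swap ((hm k).pow_const 2).aemeasurable
    _ = ∫⁻ s in Ioc (1 : ℝ) 2, ∑' k : ℤ, ∫⁻ x,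
          ‖smear (derivKernel φ) (s * 2 ^ (-k)) f x‖ₑ ^ 2 := by
        rw [lintegral_tsum fun k => ?_]
        exact ((hm k).pow_const 2).lintegral_prod_left'.aemeasurable
    _ ≤ ∫⁻ _ in Ioc (1 : ℝ) 2, 240 * kernelConstant (derivKernel φ) B * ∫⁻ x, ‖f x‖ₑ ^ 2 := by
        refine setLIntegral_mono' measurableSet_Ioc fun s hs => ?_
        simp_rw [hd]
        exact hB.tsum_lintegral_discrepancy_le hfm hf ⟨hs.1.le, hs.2⟩
    _ = _ := by rw [lintegral_const, Measure.restrict_apply_univ, hvol, mul_one]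

theorem ennreal_add_sq_le (a b : ℝ≥0∞) : (a + b) ^ 2 ≤ 2 * a ^ 2 + 2 * b ^ 2 := by
  have := sum_mul_sq_le (Finset.univ : Finset (Fin 2)) (fun _ => 1) ![a, b]
  simp only [Fin.sum_univ_two, one_mul, Matrix.cons_val_zero, Matrix.cons_val_one,
    Finset.sum_const, Finset.card_univ, Fintype.card_fin, nsmul_eq_mul, mul_one] at this
  rw [← mul_add]
  refine this.trans (le_of_eq ?_)
  norm_num

/-- The constant is chosen before the Hilbert space; this makes the final bound depend on N only
through the weights of the heights. -/
theorem exists_tsum_lintegral_blockError_sq_le (φ : 𝓢(ℝ, ℂ)) : ∃ C : ℝ≥0∞, C ≠ ∞ ∧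
    ∀ {H : Type} [NormedAddCommGroup H] [InnerProductSpace ℂ H] [CompleteSpace H] (f : ℝ → H),
      StronglyMeasurable f → MemLp f 2 volume →
      ∫⁻ x, ∑' k : ℤ, blockError φ f k x ^ 2 ≤ C * ∫⁻ x, ‖f x‖ₑ ^ 2 := by
  obtain ⟨B, hB⟩ := exists_kernelBound φ
  obtain ⟨B', hB'⟩ := exists_kernelBound (derivKernel φ)
  refine ⟨2 * (240 * kernelConstant φ B) + 2 * (240 * kernelConstant (derivKernel φ) B'), ?_, ?_⟩
  · have := kernelConstant_ne_top φ B
    have := kernelConstant_ne_top (derivKernel φ) B'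
    finiteness
  intro H _ _ _ f hfm hf
  rw [lintegral_tsum fun k => ((measurable_blockError φ hfm k).pow_const 2).aemeasurable]
  calc _ ≤ ∑' k : ℤ, (2 * (∫⁻ x, ‖discrepancy φ (1 * 2 ^ (-k)) k f x‖ₑ ^ 2) +
        2 * ∫⁻ x, blockLength φ f k x ^ 2) := by
        refine ENNReal.tsum_le_tsum fun k => ?_
        have h1 := measurable_enorm_discrepancy φ (1 * 2 ^ (-k)) k hfm
        rw [← lintegral_const_mul' _ _ (by norm_num), ← lintegral_const_mul' _ _ (by norm_num),
          ← lintegral_add_left (by fun_prop)]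
        exact lintegral_mono fun x => ennreal_add_sq_le _ _
    _ = 2 * (∑' k : ℤ, ∫⁻ x, ‖discrepancy φ (1 * 2 ^ (-k)) k f x‖ₑ ^ 2) +
        2 * ∑' k : ℤ, ∫⁻ x, blockLength φ f k x ^ 2 := by
        rw [ENNReal.tsum_add, ENNReal.tsum_mul_left, ENNReal.tsum_mul_left]
    _ ≤ 2 * (240 * kernelConstant φ B * ∫⁻ x, ‖f x‖ₑ ^ 2) +
        2 * (240 * kernelConstant (derivKernel φ) B' * ∫⁻ x, ‖f x‖ₑ ^ 2) := by
        gcongr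
        · exact hB.tsum_lintegral_discrepancy_le hfm hf ⟨le_rfl, by norm_num⟩
        · exact tsum_lintegral_blockLength_sq_le hB' hfm hf
    _ = _ := by ring

end Block

/-! ### Covering numbers of the trajectories -/

/-- Optimal covers exist because the infimum is over extended naturals; their cardinalities add by
countable subadditivity of the counting measure. -/
theorem externalCoveringNumber_iUnion_le {X : Type*} [PseudoEMetricSpace X] {ι : Type*}
    [Countable ι] (l : ℝ≥0) (A : ι → Set X) :
    (Metric.externalCoveringNumber l (⋃ i, A i) : ℝ≥0∞) ≤
      ∑' i, (Metric.externalCoveringNumber l (A i) : ℝ≥0∞) := by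
  have hex : ∀ i, ∃ C : Set X, Metric.IsCover l (A i) C ∧
      C.encard = Metric.externalCoveringNumber l (A i) := by
    intro i
    have : Nonempty {C : Set X // Metric.IsCover l (A i) C} := ⟨⟨A i, Metric.IsCover.rfl⟩⟩
    obtain ⟨C, hC⟩ := ENat.exists_eq_iInf
      (fun C : {C : Set X // Metric.IsCover l (A i) C} => (C : Set X).encard)
    exact ⟨C, C.2, by rw [hC, Metric.externalCoveringNumber, iInf_subtype]⟩
  choose C hC hcard using hex
  have hcover : Metric.IsCover l (⋃ i, A i) (⋃ i, C i) := by
    intro x hx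
    obtain ⟨i, hi⟩ := mem_iUnion.1 hx
    obtain ⟨y, hy, hxy⟩ := hC i hi
    exact ⟨y, mem_iUnion.2 ⟨i, hy⟩, hxy⟩
  refine (ENat.toENNReal_mono hcover.externalCoveringNumber_le_encard).trans ?_
  let _ : MeasurableSpace X := ⊤
  simp_rw [← hcard, ← Measure.count_apply (MeasurableSpace.measurableSet_top)]
  exact measure_iUnion_le _

section Covering

variable {H : Type*} [NormedAddCommGroup H]

theorem externalCoveringNumber_le_of_centers {l : ℝ≥0} {A : Set H} {n : ℕ} (c : Fin n → H)
    (h : ∀ a ∈ A, ∃ i, ‖a - c i‖ ≤ l) : Metric.externalCoveringNumber l A ≤ n := by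
  have hcover : Metric.IsCover l A (range c) := by
    intro a ha
    obtain ⟨i, hi⟩ := h a ha
    refine ⟨c i, mem_range_self i, ?_⟩
    change edist a (c i) ≤ l
    rw [edist_eq_enorm_sub, ← ofReal_norm]
    exact ENNReal.ofReal_le_of_le_toReal (by simpa using hi)
  refine hcover.externalCoveringNumber_le_encard.trans ?_
  rw [← image_univ]
  refine (encard_image_le _ _).trans ?_
  simp

/-- Label a parameter by the integer part of (length so far) / l. Two points with the same label are
within l, so one point per label serves as a centre. -/
theorem externalCoveringNumber_curve_le {γ : ℝ → H} {w : ℝ → ℝ≥0∞}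
    (h : ∀ a b, 1 ≤ a → a ≤ b → b ≤ 2 → ‖γ b - γ a‖ₑ ≤ ∫⁻ s in Ioc a b, w s) {l : ℝ≥0}
    (hl : 0 < l) : (Metric.externalCoveringNumber l (γ '' Icc 1 2) : ℝ≥0∞) ≤
      (∫⁻ s in Ioc (1 : ℝ) 2, w s) / l + 1 := by
  classical
  set L := ∫⁻ s in Ioc (1 : ℝ) 2, w s with hL
  by_cases hLt : L = ∞
  · have : (l : ℝ≥0∞) ≠ ∞ := ENNReal.coe_ne_top
    rw [hLt, ENNReal.top_div_of_ne_top this, top_add]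
    exact le_top
  set e : ℝ → ℝ≥0∞ := fun s => ∫⁻ u in Ioc (1 : ℝ) s, w u with he
  have heL : ∀ s, s ≤ 2 → e s ≤ L := fun s hs => lintegral_mono_set (Ioc_subset_Ioc_right hs)
  have het : ∀ s, s ≤ 2 → e s ≠ ∞ := fun s hs => ((heL s hs).trans_lt (lt_top_iff_ne_top.2 hLt)).ne
  have hadd : ∀ a b, 1 ≤ a → a ≤ b → b ≤ 2 → ‖γ b - γ a‖ ≤ (e b).toReal - (e a).toReal := by
    intro a b ha hab hb
    have h1 : e b = e a + ∫⁻ s in Ioc a b, w s := by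
      simp only [he]
      rw [← Ioc_union_Ioc_eq_Ioc ha hab, lintegral_union measurableSet_Ioc]
      exact Ioc_disjoint_Ioc_of_le le_rfl
    have h2 : ∫⁻ s in Ioc a b, w s ≠ ∞ := by
      intro h3
      rw [h3, add_top] at h1
      exact het b hb h1
    have h3 := h a b ha hab hb
    rw [h1, ENNReal.toReal_add (het a (hab.trans hb)) h2, add_sub_cancel_left]
    rw [← ofReal_norm] at h3
    exact (ENNReal.ofReal_le_iff_le_toReal h2).1 h3
  have hl' : (0 : ℝ) < l := hl
  set label : ℝ → ℕ := fun s => ⌊(e s).toReal / l⌋₊ with hlabel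
  have hlab : ∀ s, s ≤ 2 → label s < ⌊L.toReal / l⌋₊ + 1 := fun s hs =>
    Nat.lt_succ_of_le (Nat.floor_mono (by
      have := ENNReal.toReal_mono hLt (heL s hs)
      gcongr))
  have hclose : ∀ a b, 1 ≤ a → a ≤ b → b ≤ 2 → label a = label b → ‖γ b - γ a‖ ≤ l := by
    intro a b ha hab hb hlabeq
    refine (hadd a b ha hab hb).trans ?_
    have h1 := Nat.lt_floor_add_one ((e b).toReal / l)
    have h2 := Nat.floor_le (a := (e a).toReal / l) (by positivity)
    simp only [hlabel] at hlabeq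
    rw [← hlabeq] at h1
    have h3 : (e b).toReal / l < (e a).toReal / l + 1 := by linarith
    rw [div_add_one hl'.ne', div_lt_div_iff_of_pos_right hl'] at h3
    linarith
  have key : Metric.externalCoveringNumber l (γ '' Icc 1 2) ≤ (⌊L.toReal / l⌋₊ + 1 : ℕ) := by
    refine externalCoveringNumber_le_of_centers
      (fun i => if hi : ∃ s ∈ Icc (1 : ℝ) 2, label s = i then γ hi.choose else 0) ?_
    rintro _ ⟨s, hs, rfl⟩
    refine ⟨⟨label s, hlab s hs.2⟩, ?_⟩
    have hi : ∃ s' ∈ Icc (1 : ℝ) 2, label s' = label s := ⟨s, hs, rfl⟩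
    rw [dif_pos hi]
    obtain ⟨h1, h2⟩ := hi.choose_spec
    rcases le_total hi.choose s with h3 | h3
    · exact hclose _ _ h1.1 h3 hs.2 h2
    · rw [norm_sub_rev]
      exact hclose _ _ hs.1 h3 h1.2 h2.symm
  refine (ENat.toENNReal_mono key).trans ?_
  rw [ENat.toENNReal_coe, Nat.cast_succ]
  gcongr
  have h1 : ((⌊L.toReal / l⌋₊ : ℝ≥0∞)) = ENNReal.ofReal (⌊L.toReal / l⌋₊ : ℝ) := by
    rw [ENNReal.ofReal_natCast]
  rw [h1]
  refine (ENNReal.ofReal_le_ofReal (Nat.floor_le (by positivity))).trans (le_of_eq ?_)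
  rw [ENNReal.ofReal_div_of_pos hl', ENNReal.ofReal_toReal hLt, ENNReal.ofReal_coe_nnreal]

variable [InnerProductSpace ℂ H]

/-- The trajectory `{f * φ_t(x) : t > 0}`. -/
def smearOrbit (φ : 𝓢(ℝ, ℂ)) (f : ℝ → H) (x : ℝ) : Set H := {v | ∃ t : ℝ, 0 < t ∧ v = smear φ t f x}

theorem exists_dyadic_scale {t : ℝ} (ht : 0 < t) :
    ∃ k : ℤ, ∃ s ∈ Icc (1 : ℝ) 2, t = s * 2 ^ (-k) := by
  obtain ⟨n, h1, h2⟩ := exists_mem_Ico_zpow ht (one_lt_two (α := ℝ))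
  refine ⟨-n, t / 2 ^ n, ⟨?_, ?_⟩, ?_⟩
  · rwa [le_div_iff₀ (by positivity), one_mul]
  · rw [div_le_iff₀ (by positivity), ← zpow_one_add₀ (by norm_num), add_comm]
    exact h2.le
  · rw [neg_neg, div_mul_cancel₀ _ (by positivity)]

variable [CompleteSpace H]

theorem enorm_smear_sub_le_blockError (φ : 𝓢(ℝ, ℂ)) {f : ℝ → H} (hfm : StronglyMeasurable f)
    (hf : MemLp f 2 volume) (x : ℝ) (k : ℤ) {s : ℝ} (hs : s ∈ Icc (1 : ℝ) 2) :
    ‖smear φ (s * 2 ^ (-k)) f x - (∫ y, φ y) • cellExp k f x‖ₑ ≤ blockError φ f k x := by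
  have h1 := enorm_smear_sub_smear_le φ hfm hf (τ := 2 ^ (-k)) (by positivity) x le_rfl hs.1 hs.2
  have h2 : smear φ (s * 2 ^ (-k)) f x - (∫ y, φ y) • cellExp k f x =
      discrepancy φ (1 * 2 ^ (-k)) k f x +
        (smear φ (s * 2 ^ (-k)) f x - smear φ (1 * 2 ^ (-k)) f x) := by
    rw [discrepancy]; abel
  rw [h2]
  refine (enorm_add_le _ _).trans (add_le_add le_rfl (h1.trans ?_))
  exact lintegral_mono_set (Ioc_subset_Ioc_right hs.2)

/-- A block is covered by length / l + 1 balls. When its error exceeds l, both summands, multiplied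
by l², are at most the squared error; the additive 1 could not be afforded for the other blocks. -/
theorem externalCoveringNumber_block_le (φ : 𝓢(ℝ, ℂ)) {f : ℝ → H} (hfm : StronglyMeasurable f)
    (hf : MemLp f 2 volume) (x : ℝ) (k : ℤ) {l : ℝ≥0} (hl : 0 < l)
    (hk : l < blockError φ f k x) : (l : ℝ≥0∞) ^ 2 * (Metric.externalCoveringNumber l
      ((fun s => smear φ (s * 2 ^ (-k)) f x) '' Icc 1 2) : ℝ≥0∞) ≤ 2 * blockError φ f k x ^ 2 := by
  have hl0 : (l : ℝ≥0∞) ≠ 0 := by exact_mod_cast hl.ne'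
  have h1 := externalCoveringNumber_curve_le (γ := fun s => smear φ (s * 2 ^ (-k)) f x)
    (fun a b ha hab hb => enorm_smear_sub_smear_le φ hfm hf (τ := 2 ^ (-k)) (by positivity) x ha
      hab hb) hl
  have h2 : blockLength φ f k x ≤ blockError φ f k x := le_add_self
  calc _ ≤ (l : ℝ≥0∞) ^ 2 * (blockLength φ f k x / l + 1) := mul_le_mul_right h1 _
    _ = l * blockLength φ f k x + l * l := by
        rw [mul_add, mul_one, sq, mul_assoc, ENNReal.mul_div_cancel hl0 ENNReal.coe_ne_top]
    _ ≤ blockError φ f k x * blockError φ f k x + blockError φ f k x * blockError φ f k x := by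
        gcongr
    _ = _ := by ring

/-- The covering number of a trajectory is controlled by the jumps of the dyadic martingale and by
the block errors. -/
theorem externalCoveringNumber_smearOrbit_le (φ : 𝓢(ℝ, ℂ)) {f : ℝ → H}
    (hfm : StronglyMeasurable f) (hf : MemLp f 2 volume) {x : ℝ} {j k₀ : ℤ} {m : ℕ}
    (hk₀ : ∀ k ≤ k₀, ∀ n, ‖cellAverage f k n‖ₑ ≤ 2 ^ j)
    (hx : treeMax (cellAverage f) x ≤ 2 ^ (j + m)) :
    ((2 : ℝ≥0∞) ^ j) ^ 2 * (Metric.externalCoveringNumber ((‖∫ y, φ y‖ + 1) * 2 ^ j).toNNReal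
        (smearOrbit φ f x) : ℝ≥0∞) ≤
      ((2 : ℝ≥0∞) ^ j) ^ 2 * jumpCount (cellAverage f) j m k₀ x + 3 * ((2 : ℝ≥0∞) ^ j) ^ 2 +
        2 * ∑' k, blockError φ f k x ^ 2 := by
  classical
  set c := ∫ y, φ y with hc
  set N := jumpCount (cellAverage f) j m k₀ x with hN
  have h20 := two_zpow_ne_zero j
  by_cases hNt : N = ∞
  · rw [hNt, ENNReal.mul_top (pow_ne_zero _ h20), top_add, top_add]
    exact le_top
  set n : ℕ := ⌈N.toReal⌉₊ with hn
  have hNn : N ≤ n := by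
    rw [← ENNReal.ofReal_toReal hNt, ← ENNReal.ofReal_natCast]
    exact ENNReal.ofReal_le_ofReal (Nat.le_ceil _)
  have hnN : (n : ℝ≥0∞) ≤ N + 1 := by
    rw [← ENNReal.ofReal_natCast, ← ENNReal.ofReal_toReal hNt, ← ENNReal.ofReal_one,
      ← ENNReal.ofReal_add ENNReal.toReal_nonneg zero_le_one]
    exact ENNReal.ofReal_le_ofReal (Nat.ceil_lt_add_one ENNReal.toReal_nonneg).le
  obtain ⟨p, hp⟩ := exists_centers_of_jumpCount hk₀ hx hNn
  set l : ℝ≥0 := ((2 : ℝ) ^ j).toNNReal with hl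
  have hlpos : 0 < l := by rw [hl]; simp only [Real.toNNReal_pos]; positivity
  have hl2 : (l : ℝ≥0∞) = 2 ^ j := by rw [two_zpow_eq_ofReal, hl, ENNReal.ofReal]
  -- The radius is enlarged to hold ‖c‖ 2^j, from approximating the martingale by its centres, plus
  -- 2^j for the block error.
  set l' : ℝ≥0 := ((‖c‖ + 1) * 2 ^ j).toNNReal with hl'
  have hll' : l ≤ l' := Real.toNNReal_le_toNNReal (by
    have : (0 : ℝ) < 2 ^ j := by positivity
    nlinarith [norm_nonneg c])
  -- All blocks with error at most 2^j share the centres of the martingale; each remaining block is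
  -- covered by itself.
  set A : Unit ⊕ ℤ → Set H := Sum.elim
    (fun _ => {v | ∃ k : ℤ, blockError φ f k x ≤ l ∧ ∃ s ∈ Icc (1 : ℝ) 2, v = smear φ (s * 2 ^ (-k)) f x})
    (fun k => if l < blockError φ f k x then
      (fun s => smear φ (s * 2 ^ (-k)) f x) '' Icc 1 2 else ∅) with hA
  have hsub : smearOrbit φ f x ⊆ ⋃ o, A o := by
    rintro v ⟨t, ht, rfl⟩
    obtain ⟨k, s, hs, rfl⟩ := exists_dyadic_scale ht
    rcases le_or_gt (blockError φ f k x) l with h | h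
    · exact mem_iUnion.2 ⟨.inl (), k, h, s, hs, rfl⟩
    · refine mem_iUnion.2 ⟨.inr k, ?_⟩
      simp only [hA, Sum.elim_inr, if_pos h]
      exact ⟨s, hs, rfl⟩
  -- There are n + 2 centres, and rounding `N` up to n costs at most one more.
  have hgood : (Metric.externalCoveringNumber l' (A (.inl ())) : ℝ≥0∞) ≤ N + 3 := by
    have h1 : Metric.externalCoveringNumber l' (A (.inl ())) ≤ (n + 2 : ℕ) := by
      refine externalCoveringNumber_le_of_centers (fun i => c • p i) ?_
      rintro v ⟨k, hk, s, hs, rfl⟩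
      obtain ⟨i, hi⟩ := hp k
      refine ⟨i, ?_⟩
      have h2 := (enorm_smear_sub_le_blockError φ hfm hf x k hs).trans hk
      rw [← ofReal_norm, hl2, two_zpow_eq_ofReal,
        ENNReal.ofReal_le_ofReal_iff (by positivity)] at h2
      have h3 : smear φ (s * 2 ^ (-k)) f x - c • p i =
          (smear φ (s * 2 ^ (-k)) f x - c • cellExp k f x) + c • (cellExp k f x - p i) := by
        rw [smul_sub]; abel
      have h4 : ‖c • (cellExp k f x - p i)‖ ≤ ‖c‖ * 2 ^ j := by
        rw [norm_smul]
        gcongr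
        exact hi
      rw [h3, hl', Real.coe_toNNReal _ (by positivity)]
      refine (norm_add_le _ _).trans ?_
      linarith
    refine (ENat.toENNReal_mono h1).trans ?_
    rw [ENat.toENNReal_coe, Nat.cast_add]
    refine (add_le_add_left hnN _).trans (le_of_eq ?_)
    rw [add_assoc]
    norm_num
  have hbad : ∀ k : ℤ, ((2 : ℝ≥0∞) ^ j) ^ 2 *
      (Metric.externalCoveringNumber l' (A (.inr k)) : ℝ≥0∞) ≤ 2 * blockError φ f k x ^ 2 := by
    intro k
    simp only [hA, Sum.elim_inr]
    split_ifs with h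
    · rw [← hl2]
      refine le_trans ?_ (externalCoveringNumber_block_le φ hfm hf x k hlpos h)
      exact mul_le_mul_right
        (ENat.toENNReal_mono (Metric.externalCoveringNumber_anti hll')) _
    · simp
  calc _ ≤ ((2 : ℝ≥0∞) ^ j) ^ 2 * ∑' o, (Metric.externalCoveringNumber l' (A o) : ℝ≥0∞) :=
        mul_le_mul_right ((ENat.toENNReal_mono
          (Metric.externalCoveringNumber_mono_set hsub)).trans
          (externalCoveringNumber_iUnion_le l' A)) _
    _ = ((2 : ℝ≥0∞) ^ j) ^ 2 * (Metric.externalCoveringNumber l' (A (.inl ())) : ℝ≥0∞) +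
        ∑' k : ℤ, ((2 : ℝ≥0∞) ^ j) ^ 2 *
          (Metric.externalCoveringNumber l' (A (.inr k)) : ℝ≥0∞) := by
        rw [ENNReal.summable.tsum_sum ENNReal.summable, tsum_fintype, Fintype.sum_unique,
          mul_add, ENNReal.tsum_mul_left]
    _ ≤ ((2 : ℝ≥0∞) ^ j) ^ 2 * (N + 3) + ∑' k : ℤ, 2 * blockError φ f k x ^ 2 := by
        exact add_le_add (mul_le_mul_right hgood _) (ENNReal.tsum_le_tsum hbad)
    _ = _ := by
        rw [ENNReal.tsum_mul_left, mul_add, mul_comm (_ ^ 2) 3]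

theorem enorm_le_of_mem_smearOrbit (φ : 𝓢(ℝ, ℂ)) {f : ℝ → H} (hfm : StronglyMeasurable f)
    (hf : MemLp f 2 volume) {x : ℝ} {R : ℝ≥0∞} (hR : treeMax (cellAverage f) x ≤ R)
    (hQ : ∑' k, blockError φ f k x ^ 2 ≤ R ^ 2) {v : H} (hv : v ∈ smearOrbit φ f x) :
    ‖v‖ₑ ≤ (‖∫ y, φ y‖ₑ + 1) * R := by
  obtain ⟨t, ht, rfl⟩ := hv
  obtain ⟨k, s, hs, rfl⟩ := exists_dyadic_scale ht
  have h1 := enorm_smear_sub_le_blockError φ hfm hf x k hs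
  have h2 : blockError φ f k x ≤ R :=
    (ENNReal.pow_le_pow_left_iff two_ne_zero).1 ((ENNReal.le_tsum k).trans hQ)
  have h3 : ‖cellExp k f x‖ₑ ≤ R :=
    (le_iSup (fun k : ℤ => ‖cellAverage f k (cellIndex k x)‖ₑ) k).trans hR
  calc _ = ‖(∫ y, φ y) • cellExp k f x +
        (smear φ (s * 2 ^ (-k)) f x - (∫ y, φ y) • cellExp k f x)‖ₑ := by
        rw [add_sub_cancel]
    _ ≤ ‖∫ y, φ y‖ₑ * R + R := by
        refine (enorm_add_le _ _).trans (add_le_add ?_ (h1.trans h2))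
        rw [enorm_smul]
        gcongr
    _ = _ := by ring

end Covering

/-! ### The entropy integral -/

theorem entropy_anti {H : Type*} [NormedAddCommGroup H] (A : Set H) {l l' : ℝ≥0} (h : l ≤ l') :
    entropy l' A ≤ entropy l A := by
  unfold entropy
  by_cases h1 : A ⊆ Metric.closedBall 0 (l : ℝ)
  · rw [if_pos h1, if_pos (h1.trans (Metric.closedBall_subset_closedBall (by exact_mod_cast h)))]
  · rw [if_neg h1]
    split_ifs
    · exact zero_le
    · exact Metric.externalCoveringNumber_anti h

theorem entropy_le_externalCoveringNumber {H : Type*} [NormedAddCommGroup H] (A : Set H) (l : ℝ≥0) :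
    entropy l A ≤ Metric.externalCoveringNumber l A := by
  unfold entropy
  split_ifs
  · exact zero_le
  · exact le_rfl

theorem entropy_eq_zero {H : Type*} [NormedAddCommGroup H] {A : Set H} {l : ℝ≥0}
    (h : ∀ v ∈ A, ‖v‖ₑ ≤ l) : entropy l A = 0 := by
  refine if_pos fun v hv => ?_
  rw [mem_closedBall_zero_iff]
  exact_mod_cast (enorm_le_coe.1 (h v hv))

/-- The decay of the contribution of the heights `2 ^ (-i)` times the maximal height. -/
def heightWeight (N : ℕ) (q : ℝ) (i : ℕ) : ℝ≥0∞ :=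
  min 1 ((N : ℝ≥0∞) ^ (1 / 2 : ℝ) * ((2 : ℝ≥0∞) ^ (-(1 - 2 / q))) ^ i)

/-- With X = 2^(J-i) one has X M^(1/2) ≤ b and X ≤ 2^(-i) b. The second branch interpolates: X
M^(1/q) = X^(1-2/q) (X M^(1/2))^(2/q) ≤ 2^(-i(1-2/q)) b. -/
theorem mul_min_le_heightWeight_mul {N : ℕ} {q : ℝ} (hq : 2 < q) {J : ℤ} {i : ℕ} {F b M : ℝ≥0∞}
    (hJ : 2 ^ J ≤ F) (hF : F ≤ b) (hM : ((2 : ℝ≥0∞) ^ (J - i)) ^ 2 * M ≤ b ^ 2) :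
    (2 : ℝ≥0∞) ^ (J - i) * min (M ^ (1 / 2 : ℝ)) ((N : ℝ≥0∞) ^ (1 / 2 : ℝ) * M ^ (1 / q)) ≤
      heightWeight N q i * b := by
  have hq0 : 0 < q := by linarith
  have hd : 0 < 1 - 2 / q := by rw [sub_pos, div_lt_one hq0]; exact hq
  set X : ℝ≥0∞ := (2 : ℝ≥0∞) ^ (J - i) with hX
  have hXt : X ≠ ∞ := two_zpow_ne_top _
  have hX0 : X ≠ 0 := two_zpow_ne_zero _
  have h1 : X * M ^ (1 / 2 : ℝ) ≤ b := by
    rw [← ENNReal.pow_le_pow_left_iff two_ne_zero]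
    refine le_trans (le_of_eq ?_) hM
    rw [mul_pow, ← ENNReal.rpow_natCast (M ^ _), ← ENNReal.rpow_mul]
    norm_num
  have hXJ : X = 2 ^ J * 2 ^ (-(i : ℝ)) := by
    rw [hX, sub_eq_add_neg, ENNReal.zpow_add (by norm_num) (by norm_num), ← ENNReal.rpow_intCast 2 (-(i : ℤ))]
    push_cast
    rfl
  have h2 : X * M ^ (1 / q) ≤ ((2 : ℝ≥0∞) ^ (-(1 - 2 / q))) ^ i * b := by
    calc X * M ^ (1 / q) = X ^ (1 - 2 / q) * (X * M ^ (1 / 2 : ℝ)) ^ (2 / q) := by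
          rw [ENNReal.mul_rpow_of_nonneg _ _ (by positivity), ← mul_assoc,
            ← ENNReal.rpow_add _ _ hX0 hXt, ← ENNReal.rpow_mul]
          congr 1
          · rw [sub_add_cancel, ENNReal.rpow_one]
          · congr 1
            field_simp
      _ ≤ (b * 2 ^ (-(i : ℝ))) ^ (1 - 2 / q) * b ^ (2 / q) := by
          rw [hXJ] at h1 ⊢
          gcongr
          exact hJ.trans hF
      _ = _ := by
          rw [ENNReal.mul_rpow_of_nonneg _ _ hd.le, ← ENNReal.rpow_mul, mul_right_comm,
            ← ENNReal.rpow_add_of_nonneg _ _ hd.le (by positivity), sub_add_cancel,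
            ENNReal.rpow_one, mul_comm, ← ENNReal.rpow_natCast (_ ^ _), ← ENNReal.rpow_mul]
          congr 2
          ring
  rw [heightWeight]
  rcases min_choice (1 : ℝ≥0∞) ((N : ℝ≥0∞) ^ (1 / 2 : ℝ) * ((2 : ℝ≥0∞) ^ (-(1 - 2 / q))) ^ i)
    with h | h <;> rw [h]
  · rw [one_mul]
    exact (mul_le_mul_right (min_le_left _ _) _).trans h1
  · refine (mul_le_mul_right (min_le_right _ _) _).trans ?_
    rw [mul_left_comm, mul_assoc]
    gcongr

/-- With 2^J < F ≤ 2^(J+1), the range of λ is cut into the dyadic intervals starting at a 2^(J-i).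
On each the integrand is at most its value at the left end, and beyond a 2^(J+1) it vanishes. The
index i records how far λ lies below the maximum, so the gate width needed is i + 1. -/
theorem entropyIntegral_le {H : Type*} [NormedAddCommGroup H] {N : ℕ} (hN : 1 ≤ N) {q : ℝ}
    (hq : 2 < q) {A : Set H} {a : ℝ} (ha : 0 < a) {F : ℝ≥0∞} {b : ℕ → ℝ≥0∞}
    (hA : ∀ v ∈ A, ‖v‖ₑ ≤ ENNReal.ofReal a * F) (hb : ∀ i, F ≤ b i)
    (hcov : ∀ (i : ℕ) (j : ℤ), 2 ^ j < F → F ≤ 2 ^ (j + (i + 1 : ℕ)) → ((2 : ℝ≥0∞) ^ j) ^ 2 *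
      (Metric.externalCoveringNumber (a * 2 ^ j).toNNReal A : ℝ≥0∞) ≤ b i ^ 2) :
    entropyIntegral N q A ≤ ENNReal.ofReal a * ∑' i, heightWeight N q i * b i := by
  have hq0 : 0 < q := by linarith
  have ha0 : ENNReal.ofReal a ≠ 0 := by simpa using ha
  set h : ℝ → ℝ≥0∞ := fun l => min ((entropy l.toNNReal A : ℝ≥0∞) ^ (1 / 2 : ℝ))
      ((N : ℝ≥0∞) ^ (1 / 2 : ℝ) * (entropy l.toNNReal A : ℝ≥0∞) ^ (1 / q)) with hh
  have hanti : ∀ l l' : ℝ, l ≤ l' → h l' ≤ h l := fun l l' hl => by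
    have h1 : (entropy l'.toNNReal A : ℝ≥0∞) ≤ (entropy l.toNNReal A : ℝ≥0∞) :=
      ENat.toENNReal_mono (entropy_anti A (Real.toNNReal_le_toNNReal hl))
    simp only [hh]
    gcongr
  have hzero : ∀ l : ℝ, ENNReal.ofReal a * F ≤ ENNReal.ofReal l → h l = 0 := fun l hl => by
    have h1 : entropy l.toNNReal A = 0 := entropy_eq_zero fun v hv => (hA v hv).trans hl
    simp only [hh, h1, ENat.toENNReal_zero]
    rw [ENNReal.zero_rpow_of_pos (by norm_num)]
    exact min_eq_left zero_le
  change ∫⁻ l in Ioi (0 : ℝ), h l ≤ _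
  rcases eq_or_ne F 0 with rfl | hF0
  · rw [setLIntegral_congr_fun (g := fun _ => 0) measurableSet_Ioi fun l _ => hzero l (by simp)]
    simp
  rcases eq_or_ne F ∞ with rfl | hFt
  · have h1 : heightWeight N q 0 = 1 := by
      rw [heightWeight, pow_zero, mul_one]
      exact min_eq_left (ENNReal.one_le_rpow (by exact_mod_cast hN) (by norm_num))
    have h2 : (∞ : ℝ≥0∞) ≤ ∑' i, heightWeight N q i * b i := by
      refine le_trans ?_ (ENNReal.le_tsum 0)
      rw [h1, one_mul]
      exact hb 0
    rw [top_le_iff.1 h2, ENNReal.mul_top ha0]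
    exact le_top
  obtain ⟨J, hJ1, hJ2⟩ := ENNReal.exists_mem_Ioc_zpow hF0 hFt (y := 2) (by norm_num) (by norm_num)
  have hsub : Ioi (0 : ℝ) ⊆ (⋃ i : ℕ, Ioc (a * 2 ^ (J - i)) (a * 2 ^ (J - i + 1))) ∪
      Ioi (a * 2 ^ (J + 1)) := by
    intro l hl
    have hl0 : 0 < l / a := div_pos hl ha
    obtain ⟨n, hn1, hn2⟩ := exists_mem_Ioc_zpow hl0 (one_lt_two (α := ℝ))
    rw [lt_div_iff₀ ha, mul_comm] at hn1
    rw [div_le_iff₀ ha, mul_comm] at hn2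
    rcases le_or_gt n J with hnJ | hnJ
    · refine Or.inl (mem_iUnion.2 ⟨(J - n).toNat, ?_⟩)
      have : J - ((J - n).toNat : ℤ) = n := by omega
      rw [this]
      exact ⟨hn1, hn2⟩
    · refine Or.inr (lt_of_le_of_lt ?_ hn1)
      gcongr
      · norm_num
      · omega
  have hpiece : ∀ i : ℕ, ∫⁻ l in Ioc (a * 2 ^ (J - i)) (a * 2 ^ (J - i + 1)), h l ≤
      ENNReal.ofReal a * (heightWeight N q i * b i) := by
    intro i
    have hvol : volume (Ioc (a * (2 : ℝ) ^ (J - i)) (a * 2 ^ (J - i + 1))) =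
        ENNReal.ofReal a * 2 ^ (J - i) := by
      rw [Real.volume_Ioc, two_zpow_eq_ofReal, ← ENNReal.ofReal_mul ha.le,
        zpow_add_one₀ (by norm_num)]
      congr 1
      ring
    calc _ ≤ ∫⁻ _ in Ioc (a * 2 ^ (J - i)) (a * 2 ^ (J - i + 1)), h (a * 2 ^ (J - i)) :=
          setLIntegral_mono' measurableSet_Ioc fun l hl => hanti _ _ hl.1.le
      _ = ENNReal.ofReal a * (2 ^ (J - i) * h (a * 2 ^ (J - i))) := by
          rw [setLIntegral_const, hvol]; ring
      _ ≤ _ := by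
          refine mul_le_mul_right (mul_min_le_heightWeight_mul hq hJ1.le (hb i) ?_) _
          refine le_trans ?_ (hcov i (J - i) ?_ ?_)
          · exact mul_le_mul_right
              (ENat.toENNReal_mono (entropy_le_externalCoveringNumber A _)) _
          · exact (two_zpow_strictMono.monotone (by omega)).trans_lt hJ1
          · rwa [show J - (i : ℤ) + (i + 1 : ℕ) = J + 1 by push_cast; ring]
  calc ∫⁻ l in Ioi (0 : ℝ), h l ≤ ∫⁻ l in (⋃ i : ℕ, Ioc (a * 2 ^ (J - i)) (a * 2 ^ (J - i + 1))) ∪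
        Ioi (a * 2 ^ (J + 1)), h l := lintegral_mono_set hsub
    _ ≤ (∫⁻ l in ⋃ i : ℕ, Ioc (a * 2 ^ (J - i)) (a * 2 ^ (J - i + 1)), h l) +
        ∫⁻ l in Ioi (a * 2 ^ (J + 1)), h l := lintegral_union_le _ _ _
    _ ≤ (∑' i : ℕ, ∫⁻ l in Ioc (a * 2 ^ (J - i)) (a * 2 ^ (J - i + 1)), h l) + 0 := by
        refine add_le_add (lintegral_iUnion_le _ _) (le_of_eq ?_)
        rw [setLIntegral_congr_fun (g := fun _ => 0) measurableSet_Ioi, lintegral_zero]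
        intro l hl
        refine hzero l ?_
        calc _ ≤ ENNReal.ofReal a * 2 ^ (J + 1) := mul_le_mul_right hJ2 _
          _ = ENNReal.ofReal (a * 2 ^ (J + 1)) := by
            rw [two_zpow_eq_ofReal, ENNReal.ofReal_mul ha.le]
          _ ≤ _ := ENNReal.ofReal_le_ofReal (le_of_lt hl)
    _ ≤ _ := by
        rw [add_zero, ← ENNReal.tsum_mul_left]
        exact ENNReal.tsum_le_tsum hpiece

theorem min_one_le_rpow (a : ℝ≥0∞) {s : ℝ} (hs0 : 0 < s) (hs1 : s ≤ 1) : min 1 a ≤ a ^ s := by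
  rcases le_total 1 a with h | h
  · exact (min_le_left _ _).trans (ENNReal.one_le_rpow h hs0)
  · refine (min_le_right _ _).trans ?_
    conv_lhs => rw [← ENNReal.rpow_one a]
    exact ENNReal.rpow_le_rpow_of_exponent_ge h hs1

theorem tsum_heightWeight_mul_le {N : ℕ} (hN : 2 ≤ N) {q : ℝ} (hq : 2 < q) :
    ∑' i : ℕ, heightWeight N q i * (i + 1) ≤ ENNReal.ofReal (8 / Real.log 2 ^ 2) *
      ENNReal.ofReal ((Real.log N * (q / (q - 2))) ^ 2) := by
  have hq0 : 0 < q := by linarith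
  have hq2 : 0 < q - 2 := by linarith
  have hN2 : (2 : ℝ) ≤ N := by exact_mod_cast hN
  have hlog2 : 0 < Real.log 2 := Real.log_pos one_lt_two
  have hlogN : Real.log 2 ≤ Real.log N := Real.log_le_log (by norm_num) hN2
  have hlogN0 : 0 < Real.log N := hlog2.trans_le hlogN
  -- This exponent makes N^s = 2. Then min(1, a) ≤ a^s bounds the weights by 2 ρ^i with ρ = 2^(-δs),
  -- Bernoulli gives 1 - ρ ≥ δs/2, and Σ (i+1) ρ^i = (1 - ρ)^(-2) yields the constant 8 / (δs)².
  set s := Real.log 2 / Real.log N with hs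
  have hs0 : 0 < s := div_pos hlog2 hlogN0
  have hs1 : s ≤ 1 := (div_le_one hlogN0).2 hlogN
  set δ := 1 - 2 / q with hδ
  have hδq : δ = (q - 2) / q := by rw [hδ]; field_simp
  have hδ0 : 0 < δ := by rw [hδq]; positivity
  have hδ1 : δ ≤ 1 := by rw [hδ]; have : 0 < 2 / q := by positivity
                         linarith
  set ρ : ℝ := (1 / 2) ^ (δ * s) with hρ
  have hρ0 : 0 ≤ ρ := by positivity
  have hρ1 : ρ ≤ 1 - δ * s / 2 := by
    have := rpow_one_add_le_one_add_mul_self (s := -(1 / 2)) (p := δ * s) (by norm_num)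
      (by positivity) (by nlinarith)
    rw [hρ, show (1 / 2 : ℝ) = 1 + -(1 / 2) by norm_num]
    linarith
  have hρlt : ρ < 1 := by have : 0 < δ * s := by positivity
                          linarith
  have hNs : ((N : ℝ≥0∞) ^ (1 / 2 : ℝ)) ^ s ≤ 2 := by
    have h1 : (N : ℝ) ^ s = 2 := by
      rw [Real.rpow_def_of_pos (by linarith), hs, mul_div_cancel₀ _ hlogN0.ne',
        Real.exp_log (by norm_num)]
    rw [← ENNReal.rpow_mul, mul_comm, ENNReal.rpow_mul, ← ENNReal.ofReal_natCast,
      ENNReal.ofReal_rpow_of_pos (by linarith), h1, ENNReal.ofReal_ofNat]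
    calc (2 : ℝ≥0∞) ^ (1 / 2 : ℝ) ≤ 2 ^ (1 : ℝ) :=
          ENNReal.rpow_le_rpow_of_exponent_le (by norm_num) (by norm_num)
      _ = 2 := ENNReal.rpow_one 2
  have hterm : ∀ i : ℕ, heightWeight N q i * (i + 1) ≤ 2 * ENNReal.ofReal ((i + 1) * ρ ^ i) := by
    intro i
    have h1 : (((2 : ℝ≥0∞) ^ (-δ)) ^ i) ^ s = ENNReal.ofReal (ρ ^ i) := by
      rw [← ENNReal.rpow_natCast, ← ENNReal.rpow_mul, ← ENNReal.rpow_mul, ← ENNReal.ofReal_ofNat 2,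
        ENNReal.ofReal_rpow_of_pos (by norm_num), hρ, ← Real.rpow_natCast, ← Real.rpow_mul (by norm_num),
        one_div, Real.inv_rpow (by norm_num), ← Real.rpow_neg (by norm_num)]
      congr 2
      ring
    have h2 : ((i : ℝ≥0∞) + 1) = ENNReal.ofReal (i + 1) := by
      rw [ENNReal.ofReal_add (by positivity) (by norm_num)]; simp
    calc _ ≤ ((N : ℝ≥0∞) ^ (1 / 2 : ℝ) * ((2 : ℝ≥0∞) ^ (-δ)) ^ i) ^ s * (i + 1) := by
          gcongr
          exact min_one_le_rpow _ hs0 hs1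
      _ ≤ 2 * ENNReal.ofReal (ρ ^ i) * (i + 1) := by
          rw [ENNReal.mul_rpow_of_nonneg _ _ hs0.le, h1]
          gcongr
      _ = _ := by
          rw [h2, mul_assoc, ← ENNReal.ofReal_mul (by positivity), mul_comm (ρ ^ i)]
  have hnorm : ‖ρ‖ < 1 := by rwa [Real.norm_of_nonneg hρ0]
  have hsum : HasSum (fun i : ℕ => ((i : ℝ) + 1) * ρ ^ i) (1 / (1 - ρ) ^ 2) := by
    have := (hasSum_coe_mul_geometric_of_norm_lt_one hnorm).add (hasSum_geometric_of_lt_one hρ0 hρlt)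
    have h1 : (0 : ℝ) < 1 - ρ := by linarith
    have h2 : (fun i : ℕ => ((i : ℝ) + 1) * ρ ^ i) = fun i : ℕ => i * ρ ^ i + ρ ^ i := by
      funext i; ring
    have h3 : 1 / (1 - ρ) ^ 2 = ρ / (1 - ρ) ^ 2 + (1 - ρ)⁻¹ := by field_simp; ring
    rw [h2, h3]
    exact this
  calc _ ≤ ∑' i : ℕ, 2 * ENNReal.ofReal ((i + 1) * ρ ^ i) := ENNReal.tsum_le_tsum hterm
    _ = ENNReal.ofReal (2 * (1 / (1 - ρ) ^ 2)) := by
        rw [ENNReal.tsum_mul_left, ← ENNReal.ofReal_tsum_of_nonneg (fun i => by positivity)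
          hsum.summable, hsum.tsum_eq, ENNReal.ofReal_mul (by norm_num), ENNReal.ofReal_ofNat]
    _ ≤ _ := by
        rw [← ENNReal.ofReal_mul (by positivity)]
        refine ENNReal.ofReal_le_ofReal ?_
        have h1 : δ * s / 2 ≤ 1 - ρ := by linarith
        have h2 : 0 < δ * s / 2 := by positivity
        calc 2 * (1 / (1 - ρ) ^ 2) ≤ 2 * (1 / (δ * s / 2) ^ 2) := by gcongr
          _ = _ := by
            rw [hδq, hs]
            field_simp
            ring

/-! ### The vector-valued estimate -/

theorem sq_rpow_half (a : ℝ≥0∞) : (a ^ (1 / 2 : ℝ)) ^ 2 = a := by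
  rw [← ENNReal.rpow_natCast, ← ENNReal.rpow_mul]
  norm_num

theorem rpow_half_sq (a : ℝ≥0∞) : (a ^ 2) ^ (1 / 2 : ℝ) = a := by
  rw [← ENNReal.rpow_natCast, ← ENNReal.rpow_mul]
  norm_num

theorem eLpNorm_two_eq {E : Type*} [TopologicalSpace E] [ContinuousENorm E] (g : ℝ → E) :
    eLpNorm g 2 volume = (∫⁻ x, ‖g x‖ₑ ^ 2) ^ (1 / 2 : ℝ) := by
  rw [eLpNorm_eq_lintegral_rpow_enorm_toReal (by norm_num) (by norm_num)]
  norm_num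

/-- A weighted sum of functions whose squared norms grow linearly. -/
theorem lintegral_tsum_mul_sq_le {c : ℕ → ℝ≥0∞} {D : ℕ → ℝ → ℝ≥0∞} (hD : ∀ i, Measurable (D i))
    {E : ℝ≥0∞} (hE : ∀ i : ℕ, ∫⁻ x, D i x ≤ (i + 1) * E) :
    ∫⁻ x, (∑' i, c i * D i x ^ (1 / 2 : ℝ)) ^ 2 ≤ (∑' i : ℕ, c i * (i + 1)) ^ 2 * E := by
  set S := ∑' i : ℕ, c i * (i + 1) with hS
  have hn0 : ∀ i : ℕ, (i + 1 : ℝ≥0∞) ≠ 0 := fun i => by simp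
  have hnt : ∀ i : ℕ, (i + 1 : ℝ≥0∞) ≠ ∞ := fun i => by simp
  -- Cauchy–Schwarz with weights c_i (i+1). After integration a factor (i+1)^(-2) meets growth i+1,
  -- and the surplus (i+1)^(-1) is bounded by 1.
  have hpt : ∀ x, (∑' i, c i * D i x ^ (1 / 2 : ℝ)) ^ 2 ≤
      S * ∑' i : ℕ, c i * (i + 1) * (((i + 1 : ℝ≥0∞)⁻¹) ^ 2 * D i x) := by
    intro x
    have h1 : ∀ i : ℕ, c i * D i x ^ (1 / 2 : ℝ) =
        c i * (i + 1) * ((i + 1 : ℝ≥0∞)⁻¹ * D i x ^ (1 / 2 : ℝ)) := fun i => by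
      rw [mul_assoc, ← mul_assoc (i + 1 : ℝ≥0∞), ENNReal.mul_inv_cancel (hn0 i) (hnt i), one_mul]
    simp_rw [h1]
    refine (tsum_mul_sq_le _ _).trans (le_of_eq ?_)
    simp_rw [mul_pow, sq_rpow_half, hS]
  calc _ ≤ ∫⁻ x, S * ∑' i : ℕ, c i * (i + 1) * (((i + 1 : ℝ≥0∞)⁻¹) ^ 2 * D i x) :=
        lintegral_mono hpt
    _ = S * ∑' i : ℕ, c i * (i + 1) * (((i + 1 : ℝ≥0∞)⁻¹) ^ 2 * ∫⁻ x, D i x) := by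
        rw [lintegral_const_mul _ (by fun_prop), lintegral_tsum fun i => by fun_prop]
        congr 2
        ext i
        rw [lintegral_const_mul _ (by fun_prop), lintegral_const_mul _ (hD i)]
    _ ≤ S * ∑' i : ℕ, c i * (i + 1) * E := by
        gcongr with i
        calc ((i + 1 : ℝ≥0∞)⁻¹) ^ 2 * ∫⁻ x, D i x ≤ ((i + 1 : ℝ≥0∞)⁻¹) ^ 2 * ((i + 1) * E) := by
              gcongr; exact hE i
          _ = (i + 1 : ℝ≥0∞)⁻¹ * ((i + 1 : ℝ≥0∞) * (i + 1 : ℝ≥0∞)⁻¹) * E := by ring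
          _ ≤ 1 * E := by
              rw [ENNReal.mul_inv_cancel (hn0 i) (hnt i), mul_one]
              gcongr
              exact ENNReal.inv_le_one.2 le_add_self
          _ = E := one_mul E
    _ = S ^ 2 * E := by rw [ENNReal.tsum_mul_right, sq, mul_assoc]

/-- The `L²` bound for the entropy integral of the trajectories of a vector-valued function. -/
theorem exists_lintegral_entropyIntegral_smearOrbit_sq_le (φ : 𝓢(ℝ, ℂ)) :
    ∃ C : ℝ≥0∞, C ≠ ∞ ∧ ∀ {H : Type} [NormedAddCommGroup H] [InnerProductSpace ℂ H]
      [CompleteSpace H] {N : ℕ} (_ : 2 ≤ N) {q : ℝ} (_ : 2 < q) {f : ℝ → H}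
      (_ : StronglyMeasurable f) (_ : MemLp f 2 volume),
      ∫⁻ x, entropyIntegral N q (smearOrbit φ f x) ^ 2 ≤
        C * ENNReal.ofReal ((Real.log N * (q / (q - 2))) ^ 2) ^ 2 * ∫⁻ x, ‖f x‖ₑ ^ 2 := by
  obtain ⟨C, hC, hsq⟩ := exists_tsum_lintegral_blockError_sq_le φ
  set a : ℝ := ‖∫ y, φ y‖ + 1 with ha
  have ha0 : 0 < a := by positivity
  refine ⟨ENNReal.ofReal a ^ 2 * (ENNReal.ofReal (8 / Real.log 2 ^ 2) ^ 2 * (1 + 5 * (8 + 2 * C))),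
    by finiteness, ?_⟩
  intro H _ _ _ N hN q hq f hfm hf
  set E := ∫⁻ x, ‖f x‖ₑ ^ 2 with hE
  have hEt : E ≠ ∞ := by
    intro h
    have h1 := hf.2
    rw [eLpNorm_two_eq, ← hE, h, ENNReal.top_rpow_of_pos (by norm_num)] at h1
    exact lt_irrefl _ h1
  set U := cellAverage f with hU
  have hUm : IsTreeMartingale U := isTreeMartingale_cellAverage hf
  have hB : ∀ k, ∫⁻ x, ENNReal.ofReal (‖U k (cellIndex k x)‖ ^ 2) ≤ E := fun k => by
    simp_rw [← enorm_sq_eq_ofReal]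
    exact lintegral_cellAverage_sq_le hf k
  choose k₀ hk₀ using exists_coarse_level hB hEt
  set Q : ℝ → ℝ≥0∞ := fun x => ∑' k, blockError φ f k x ^ 2 with hQ
  have hQm : Measurable Q := Measurable.tsum fun k => (measurable_blockError φ hfm k).pow_const 2
  -- F dominates both the maximal function and every block error, so the whole trajectory lies in
  -- the ball of radius a F about 0.
  set F : ℝ → ℝ≥0∞ := fun x => treeMax U x + Q x ^ (1 / 2 : ℝ) with hF
  have hFm : Measurable F := (measurable_treeMax U).add (hQm.pow_const _)
  set P : ℕ → ℝ → ℝ≥0∞ := fun i x => ∑' j : ℤ, ((2 : ℝ≥0∞) ^ j) ^ 2 *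
    jumpCount U j (i + 1) (k₀ j) x with hP
  have hPm : ∀ i, Measurable (P i) := fun i =>
    Measurable.tsum fun j => (measurable_jumpCount j (i + 1) (k₀ j)).const_mul _
  -- The 5 collects the terms 3 · 2^(2j) ≤ 3 F² and 2 Q ≤ 2 F² of the covering estimate.
  set D : ℕ → ℝ → ℝ≥0∞ := fun i x => P i x + 5 * F x ^ 2 with hD
  have hDm : ∀ i, Measurable (D i) := fun i => (hPm i).add ((hFm.pow_const 2).const_mul 5)
  have hQF : ∀ x, Q x ≤ F x ^ 2 := fun x => by
    conv_lhs => rw [← sq_rpow_half (Q x)]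
    exact pow_le_pow_left' le_add_self 2
  have hFD : ∫⁻ x, F x ^ 2 ≤ (8 + 2 * C) * E := by
    calc _ ≤ ∫⁻ x, (2 * treeMax U x ^ 2 + 2 * Q x) := lintegral_mono fun x => by
          have := ennreal_add_sq_le (treeMax U x) (Q x ^ (1 / 2 : ℝ))
          rwa [sq_rpow_half] at this
      _ = 2 * (∫⁻ x, treeMax U x ^ 2) + 2 * ∫⁻ x, Q x := by
          have hm := (measurable_treeMax U).pow_const 2
          rw [lintegral_add_left (hm.const_mul 2), lintegral_const_mul _ hm,
            lintegral_const_mul _ hQm]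
      _ ≤ 2 * (4 * E) + 2 * (C * E) := by
          exact add_le_add (mul_le_mul_right (hUm.lintegral_treeMax_sq_le hB) 2)
            (mul_le_mul_right (hsq f hfm hf) 2)
      _ = _ := by ring
  have hDE : ∀ i : ℕ, ∫⁻ x, D i x ≤ (i + 1) * ((1 + 5 * (8 + 2 * C)) * E) := fun i => by
    calc _ = (∫⁻ x, P i x) + 5 * ∫⁻ x, F x ^ 2 := by
          rw [lintegral_add_left (hPm i), lintegral_const_mul _ (hFm.pow_const 2)]
      _ ≤ (i + 1) * E + (i + 1) * (5 * ((8 + 2 * C) * E)) := by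
          refine add_le_add ?_ ?_
          · exact_mod_cast hUm.lintegral_tsum_jumpCount_le hB k₀ (i + 1)
          · refine le_trans (mul_le_mul_right hFD 5) (le_mul_of_one_le_left' le_add_self)
      _ = _ := by ring
  have hpt : ∀ x, entropyIntegral N q (smearOrbit φ f x) ≤
      ENNReal.ofReal a * ∑' i, heightWeight N q i * D i x ^ (1 / 2 : ℝ) := by
    intro x
    refine entropyIntegral_le (by omega) hq ha0 (F := F x) ?_ ?_ ?_
    · intro v hv
      have := enorm_le_of_mem_smearOrbit φ hfm hf (R := F x) le_self_add (hQF x) hv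
      rwa [ha, ENNReal.ofReal_add (norm_nonneg _) zero_le_one, ENNReal.ofReal_one,
        ofReal_norm]
    · intro i
      conv_lhs => rw [← rpow_half_sq (F x)]
      refine ENNReal.rpow_le_rpow ?_ (by norm_num)
      calc F x ^ 2 = 1 * F x ^ 2 := (one_mul _).symm
        _ ≤ 5 * F x ^ 2 := by gcongr; norm_num
        _ ≤ D i x := le_add_self
    · intro i j hj1 hj2
      rw [sq_rpow_half]
      refine (externalCoveringNumber_smearOrbit_le φ hfm hf (hk₀ j)
        (le_self_add.trans hj2)).trans ?_
      calc _ ≤ P i x + 3 * F x ^ 2 + 2 * F x ^ 2 := by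
            gcongr
            · exact ENNReal.le_tsum (f := fun j : ℤ => ((2 : ℝ≥0∞) ^ j) ^ 2 *
                jumpCount U j (i + 1) (k₀ j) x) j
            · exact hQF x
        _ = D i x := by simp only [hD]; ring
  calc _ ≤ ∫⁻ x, ENNReal.ofReal a ^ 2 *
        (∑' i, heightWeight N q i * D i x ^ (1 / 2 : ℝ)) ^ 2 := lintegral_mono fun x => by
          rw [← mul_pow]
          gcongr
          exact hpt x
    _ = ENNReal.ofReal a ^ 2 *
        ∫⁻ x, (∑' i, heightWeight N q i * D i x ^ (1 / 2 : ℝ)) ^ 2 :=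
          lintegral_const_mul' _ _ (by finiteness)
    _ ≤ ENNReal.ofReal a ^ 2 * ((ENNReal.ofReal (8 / Real.log 2 ^ 2) *
          ENNReal.ofReal ((Real.log N * (q / (q - 2))) ^ 2)) ^ 2 * ((1 + 5 * (8 + 2 * C)) * E)) := by
        refine mul_le_mul_right ((lintegral_tsum_mul_sq_le hDm hDE).trans ?_) _
        gcongr
        exact tsum_heightWeight_mul_le hN hq
    _ = _ := by ring

/-! ### Reduction to measurable vector-valued functions -/

theorem smear_apply {N : ℕ} (φ : 𝓢(ℝ, ℂ)) {f : ℝ → EuclideanSpace ℂ (Fin N)}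
    (hf : MemLp f 2 volume) {t : ℝ} (ht : 0 < t) (x : ℝ) (j : Fin N) :
    smear φ t f x j =
      ((fun y => f y j) ⋆[ContinuousLinearMap.mul ℂ ℂ, volume] dilate φ t) x := by
  obtain ⟨B, hB⟩ := exists_kernelBound φ
  have h := (EuclideanSpace.proj (𝕜 := ℂ) j).integral_comp_comm (hB.integrable_dilate_smul hf ht x)
  rw [smear, convolution_def]
  refine h.symm.trans (integral_congr_ae (ae_of_all _ fun y => ?_))
  simp [mul_comm]

/-- Convolution integrals ignore null sets, so passing to a strongly measurable representative
changes the trajectory at no point `x`. -/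
theorem trajectory_eq_smearOrbit {N : ℕ} (φ : 𝓢(ℝ, ℂ)) {f : Fin N → ℝ → ℂ}
    {g : ℝ → EuclideanSpace ℂ (Fin N)} (hg : MemLp g 2 volume)
    (hfg : ∀ j, f j =ᵐ[volume] fun x => g x j) (x : ℝ) :
    trajectory φ f x = smearOrbit φ g x := by
  have key : ∀ t, 0 < t → ∀ j, (f j ⋆[ContinuousLinearMap.mul ℂ ℂ, volume] dilate φ t) x =
      smear φ t g x j := fun t ht j => by
    rw [smear_apply φ hg ht x j, convolution_def, convolution_def]
    refine integral_congr_ae ?_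
    filter_upwards [hfg j] with y hy
    rw [hy]
  ext v
  constructor
  · rintro ⟨t, ht, h⟩
    refine ⟨t, ht, ?_⟩
    ext j
    rw [h j, key t ht j]
  · rintro ⟨t, ht, rfl⟩
    exact ⟨t, ht, fun j => (key t ht j).symm⟩

theorem exists_stronglyMeasurable_vector {N : ℕ} {f : Fin N → ℝ → ℂ}
    (hf : ∀ j, MemLp (f j) 2 volume) :
    ∃ g : ℝ → EuclideanSpace ℂ (Fin N), StronglyMeasurable g ∧ MemLp g 2 volume ∧
      ∀ j, f j =ᵐ[volume] fun x => g x j := by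
  set g : ℝ → EuclideanSpace ℂ (Fin N) := fun x => WithLp.toLp 2 fun j => (hf j).1.mk (f j) x
    with hg
  have hgm : StronglyMeasurable g :=
    (PiLp.continuous_toLp 2 (fun _ : Fin N => ℂ)).comp_stronglyMeasurable
      (measurable_pi_iff.2 fun j => (hf j).1.stronglyMeasurable_mk.measurable).stronglyMeasurable
  refine ⟨g, hgm, ?_, fun j => (hf j).1.ae_eq_mk⟩
  have h1 : ∀ j, MemLp ((hf j).1.mk (f j)) 2 volume := fun j =>
    (memLp_congr_ae (hf j).1.ae_eq_mk).1 (hf j)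
  have h2 : MemLp (fun x => ∑ j, ‖(hf j).1.mk (f j) x‖) 2 volume :=
    memLp_finsetSum _ fun j _ => (h1 j).norm
  refine h2.mono hgm.aestronglyMeasurable (ae_of_all _ fun x => ?_)
  rw [EuclideanSpace.norm_eq, Real.norm_of_nonneg (by positivity)]
  exact Real.sqrt_le_iff.2 ⟨by positivity,
    Finset.sum_sq_le_sq_sum_of_nonneg fun j _ => norm_nonneg _⟩

end

theorem mainTheorem5 (φ : 𝓢(ℝ, ℂ))
    (hφ : tsupport (𝓕 (φ : ℝ → ℂ)) ⊆ Icc (-(1 / 2) : ℝ) (1 / 2)) :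
    ∃ C : ℝ≥0, ∀ (N : ℕ) (_ : 2 ≤ N) (q : ℝ) (_ : 2 < q)
      (f : Fin N → ℝ → ℂ) (_ : ∀ j, MemLp (f j) 2 volume),
      eLpNorm (fun x => entropyIntegral N q (trajectory φ f x)) 2 volume ≤
        (C : ℝ≥0∞) * ENNReal.ofReal ((Real.log N * (q / (q - 2))) ^ 2) *
          eLpNorm (fun x => Real.sqrt (∑ j, ‖f j x‖ ^ 2)) 2 volume := by
  obtain ⟨C, hC, h⟩ := exists_lintegral_entropyIntegral_smearOrbit_sq_le φ
  refine ⟨(C ^ (1 / 2 : ℝ)).toNNReal, fun N hN q hq f hf => ?_⟩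
  obtain ⟨g, hgm, hg, hfg⟩ := exists_stronglyMeasurable_vector hf
  have hnorm : eLpNorm (fun x => Real.sqrt (∑ j, ‖f j x‖ ^ 2)) 2 volume = eLpNorm g 2 volume := by
    refine eLpNorm_congr_norm_ae ?_
    filter_upwards [ae_all_iff.2 hfg] with x hx
    rw [Real.norm_of_nonneg (Real.sqrt_nonneg _), EuclideanSpace.norm_eq]
    simp_rw [hx]
  rw [hnorm, eLpNorm_two_eq, eLpNorm_two_eq,
    ENNReal.coe_toNNReal (ENNReal.rpow_ne_top_of_nonneg (by norm_num) hC)]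
  simp_rw [enorm_eq_self, trajectory_eq_smearOrbit φ hg hfg]
  refine (ENNReal.rpow_le_rpow (h hN hq hgm hg) (by norm_num)).trans (le_of_eq ?_)
  rw [ENNReal.mul_rpow_of_nonneg _ _ (by norm_num), ENNReal.mul_rpow_of_nonneg _ _ (by norm_num),
    rpow_half_sq]
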